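/- Let $k$ be an infinite field of characteristic different from $2$ and $3$, and let $\mathbb{O}=\mathrm{M}_2(k)\oplus \mathrm{M}_2(k)$ be the split octonion algebra over $k$, with trace $\mathrm{tr}$, conjugation $x\mapsto\overline{x}$ and norm $\|\cdot\|$. Let $\mathcal{J}$ be the $27$-dimensional space of Hermitian matrices $$X=\begin{pmatrix} s_1 & x_3 & \overline{x_2}\\ \overline{x_3} & s_2 & x_1\\ x_2 & \overline{x_1} & s_3\end{pmatrix},\qquad s_i\in k,\ x_i\in\mathbb{O},$$ with the cubic form $\det X=s_1s_2s_3+\mathrm{tr}((x_1x_2)x_3)-s_1\|x_1\|-s_2\|x_2\|-s_3\|x_3\|$. Let $GE_6(k)$ be the group of $g\in \mathrm{GL}(\mathcal{J})$ such that, for some $c\in k^\times$, $\det(gX)=c\det X$ for all $X\in\mathcal J$. Let $G_k=GE_6(k)\times \mathrm{GL}_2(k)$ act on $V_k=\mathcal{J}\otimes k^2$, regarded as the space of pairs $x=(x_1,x_2)$ of elements of $\mathcal J$. Let $V^{\mathrm{ss}}_k$ be the set of $x\in V_k$ for which the binary cubic form $F_x(v)=\det(x_1v_1+x_2v_2)$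 has nonzero discriminant. Let $\mathcal{V}_k\subset V_k$ be the subspace of pairs of ternary quadratic forms (pairs of symmetric $3\times 3$ matrices over $k$), and let $\mathcal{V}^{\mathrm{ss}}_k\subset\mathcal{V}_k$ be the set of pairs $x$ for which the discriminant of $F_x$ (with the usual determinant of symmetric matrices) is nonzero. For $x\in\mathcal{V}^{\mathrm{ss}}_k$ let $\mathrm{Zero}_{\mathbb{P}^2}(x)\subset\mathbb{P}^2(\overline{k})$ be the intersection of the two conics defined by $x_1$ and $x_2$; it consists of four distinct points with coordinates in $k^{\mathrm{sep}}$. Identify $\mathrm{H}^1(k,\mathfrak{S}_4)$ with the set of conjugacy classes of continuous homomorphisms $\mathrm{Gal}(k^{\mathrm{sep}}/k)\to\mathfrak{S}_4$ (trivial Galois action on $\mathfrak{S}_4$). The class corresponding to $x$ is that of the homomorphism given by the action of $\mathrm{Gal}(k^{\mathrm{sep}}/k)$ on $\mathrm{Zero}_{\mathbb{P}^2}(x)$, with its points numbered $1,2,3,4$. Let $\mathcal{S}\subset\mathfrak{S}_4$ be the stabilizer of $4$. Then $\mathcal{S}\cong\mathfrak{S}_3$, and every $G_k$-orbit in $V^{\mathrm{ss}}_k$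 has a representative $x\in\mathcal{V}^{\mathrm{ss}}_k$ such that $\mathrm{Zero}_{\mathbb{P}^2}(x)$ contains a $k$-rational point and the class in $\mathrm{H}^1(k,\mathfrak{S}_4)$ corresponding to $x$ lies in the image of the natural map $\mathrm{H}^1(k,\mathcal{S})\to\mathrm{H}^1(k,\mathfrak{S}_4)$. -/

import Mathlib

open scoped Matrix LinearAlgebra.Projectivization

noncomputable section

namespace JordanPairs

/-! ### The split octonions -/

/-- The split octonion algebra over `k`, with underlying space `M₂(k) ⊕ M₂(k)`. -/
def Octonion (k : Type*) : Type _ := Matrix (Fin 2) (Fin 2) k × Matrix (Fin 2) (Fin 2) k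

namespace Octonion

variable {k : Type*} [Field k]

instance : AddCommGroup (Octonion k) :=
  inferInstanceAs (AddCommGroup (Matrix (Fin 2) (Fin 2) k × Matrix (Fin 2) (Fin 2) k))

instance : Module k (Octonion k) :=
  inferInstanceAs (Module k (Matrix (Fin 2) (Fin 2) k × Matrix (Fin 2) (Fin 2) k))

/-- The Cayley–Dickson product `(a, b)(c, d) = (a c + d* b, d a + b c*)`, where `*` (the adjugate)
is the canonical involution of the quaternion algebra `M₂(k)`. -/
instance : Mul (Octonion k) :=
  ⟨fun x y => (x.1 * y.1 + y.2.adjugate * x.2, y.2 * x.1 + x.2 * y.1.adjugate)⟩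

instance : One (Octonion k) := ⟨(1, 0)⟩

/-- Octonion conjugation `(a, b) ↦ (a*, -b)`. -/
def conj (x : Octonion k) : Octonion k := (x.1.adjugate, -x.2)

/-- The trace, `x + conj x = tr x • 1`. -/
def tr (x : Octonion k) : k := x.1.trace

/-- The norm `‖x‖`, a quadratic form with `x * conj x = norm x • 1`. -/
def norm (x : Octonion k) : k := x.1.det - x.2.det

theorem add_conj (x : Octonion k) : x + conj x = tr x • (1 : Octonion k) := by
  refine Prod.ext ?_ ?_
  · change x.1 + x.1.adjugate = x.1.trace • (1 : Matrix (Fin 2) (Fin 2) k)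
    ext i j
    fin_cases i <;> fin_cases j <;> simp [Matrix.adjugate_fin_two, Matrix.trace_fin_two, add_comm]
  · change x.2 + -x.2 = x.1.trace • (0 : Matrix (Fin 2) (Fin 2) k)
    simp

theorem mul_conj (x : Octonion k) : x * conj x = norm x • (1 : Octonion k) := by
  refine Prod.ext ?_ ?_
  · change x.1 * x.1.adjugate + (-x.2).adjugate * x.2
      = (x.1.det - x.2.det) • (1 : Matrix (Fin 2) (Fin 2) k)
    ext i j
    fin_cases i <;> fin_cases j <;>
      simp [Matrix.adjugate_fin_two, Matrix.det_fin_two, Matrix.mul_apply, Matrix.vecMul,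
        dotProduct, Fin.sum_univ_two] <;> ring
  · change -x.2 * x.1 + x.2 * x.1.adjugate.adjugate
      = (x.1.det - x.2.det) • (0 : Matrix (Fin 2) (Fin 2) k)
    ext i j
    fin_cases i <;> fin_cases j <;>
      simp [Matrix.adjugate_fin_two, Matrix.mul_apply, Fin.sum_univ_two]

end Octonion

/-! ### The exceptional Jordan algebra and the group `GE₆` -/

/-- The `27`-dimensional space of Hermitian `3 × 3` matrices over the octonions. The pair
`(s, x)` stands for the matrix with rows
`(s 0, x 2, conj (x 1))`, `(conj (x 2), s 1, x 0)`, `(x 1, conj (x 0), s 2)`. -/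
abbrev J (k : Type*) : Type _ := (Fin 3 → k) × (Fin 3 → Octonion k)

variable {k : Type*} [Field k]

/-- The determinant (cubic norm) of the exceptional Jordan algebra. -/
def J.det (X : J k) : k :=
  X.1 0 * X.1 1 * X.1 2 + (X.2 0 * X.2 1 * X.2 2).tr
    - X.1 0 * (X.2 0).norm - X.1 1 * (X.2 1).norm - X.1 2 * (X.2 2).norm

variable (k) in
/-- `GE₆(k)`: the invertible linear maps of `J` that multiply the determinant by a
nonzero scalar. -/
def GE6 : Subgroup (J k ≃ₗ[k] J k) where
  carrier := {g | ∃ c : kˣ, ∀ X : J k, J.det (g X) = c * J.det X}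
  one_mem' := ⟨1, fun X => by simp⟩
  mul_mem' := by
    rintro g h ⟨c, hc⟩ ⟨d, hd⟩
    exact ⟨c * d, fun X => by simp [LinearEquiv.mul_apply, hc, hd, mul_assoc]⟩
  inv_mem' := by
    rintro g ⟨c, hc⟩
    refine ⟨c⁻¹, fun X => ?_⟩
    have h := hc (g⁻¹ X)
    have hg : g (g⁻¹ X) = X := LinearEquiv.apply_symm_apply g X
    rw [hg] at h
    rw [h, ← mul_assoc, Units.inv_mul, one_mul]

/-- `V = J ⊗ Aff²`, the space of pairs of elements of `J`. -/
abbrev V (k : Type*) : Type _ := Fin 2 → J k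

variable (k) in
/-- The rational points of `G = GE₆ × GL(2)`. -/
abbrev G : Type _ := GE6 k × GL (Fin 2) k

/-- `G` acts on `V = J ⊗ Aff²` by the tensor product of the natural representation of `GE₆` and
the standard representation of `GL(2)`. -/
instance : MulAction (G k) (V k) where
  smul g x := fun i => ∑ j, (g.2 : Matrix (Fin 2) (Fin 2) k) i j • (g.1 : J k ≃ₗ[k] J k) (x j)
  one_smul x := by
    funext i
    change ∑ j, (1 : Matrix (Fin 2) (Fin 2) k) i j • x j = x i
    simp [Matrix.one_apply]
  mul_smul g h x := by
    funext i
    change ∑ j, ((g.2 : Matrix (Fin 2) (Fin 2) k) * (h.2 : Matrix (Fin 2) (Fin 2) k)) i j •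
        (g.1 : J k ≃ₗ[k] J k) ((h.1 : J k ≃ₗ[k] J k) (x j))
      = ∑ j, (g.2 : Matrix (Fin 2) (Fin 2) k) i j • (g.1 : J k ≃ₗ[k] J k)
          (∑ l, (h.2 : Matrix (Fin 2) (Fin 2) k) j l • (h.1 : J k ≃ₗ[k] J k) (x l))
    simp only [Fin.sum_univ_two, Matrix.mul_apply, map_add, map_smul]
    module

/-! ### The binary cubic form of a pair, semi-stable points -/

/-- For a cubic form `D` on a vector space and a pair `x = (x₁, x₂)`, the binary cubic form
`F_x(v) = D(x₁ v₁ + x₂ v₂) = a v₁³ + b v₁² v₂ + c v₁ v₂² + d v₂³`; its coefficients are read off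
from its values at `(1, 0)`, `(0, 1)`, `(1, 1)`, `(1, -1)`. -/
def binaryCubic {M : Type*} [AddCommGroup M] (D : M → k) (x : Fin 2 → M) : Cubic k where
  a := D (x 0)
  b := (D (x 0 + x 1) - D (x 0 - x 1)) / 2 - D (x 1)
  c := (D (x 0 + x 1) + D (x 0 - x 1)) / 2 - D (x 0)
  d := D (x 1)

variable (k) in
/-- The semi-stable points of `V`: the discriminant of `F_x(v) = det (x₁ v₁ + x₂ v₂)` is
nonzero. -/
def Vss : Set (V k) := {x | (binaryCubic J.det x).discr ≠ 0}

/-! ### Pairs of ternary quadratic forms -/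

variable (k) in
/-- Ternary quadratic forms, as symmetric `3 × 3` matrices. -/
def TernaryForm : Submodule k (Matrix (Fin 3) (Fin 3) k) where
  carrier := {A | A.IsSymm}
  add_mem' := Matrix.IsSymm.add
  zero_mem' := Matrix.isSymm_zero
  smul_mem' c _ hA := hA.smul c

/-- The space `𝒱` of pairs of ternary quadratic forms. -/
abbrev QPair (k : Type*) [Field k] : Type _ := Fin 2 → TernaryForm k

variable (k) in
/-- The semi-stable points `𝒱ˢˢ`: the discriminant of `F_x(v) = det (x₁ v₁ + x₂ v₂)` is
nonzero. -/
def QPairss : Set (QPair k) :=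
  {x | (binaryCubic (fun A : TernaryForm k => (A : Matrix (Fin 3) (Fin 3) k).det) x).discr ≠ 0}

/-- A symmetric matrix over `k`, regarded as a Hermitian matrix over the octonions. -/
def TernaryForm.toJ (A : TernaryForm k) : J k :=
  (fun i => A.1 i i, ![A.1 1 2 • 1, A.1 2 0 • 1, A.1 0 1 • 1])

/-- On ternary quadratic forms the determinant of `J` is the determinant of the matrix. -/
theorem TernaryForm.det_toJ (A : TernaryForm k) : J.det (TernaryForm.toJ A) = A.1.det := by
  have h := A.2
  have e : ∀ i j, A.1 i j = A.1 j i := fun i j => (Matrix.IsSymm.apply h j i)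
  have a5 : ∀ (c : k), (c • (1 : Octonion k)).1 = c • (1 : Matrix (Fin 2) (Fin 2) k) := fun _ => rfl
  have a6 : ∀ (c : k), (c • (1 : Octonion k)).2 = c • (0 : Matrix (Fin 2) (Fin 2) k) := fun _ => rfl
  have a7 : ∀ x y : Octonion k, (x * y).1 = x.1 * y.1 + y.2.adjugate * x.2 := fun _ _ => rfl
  have a8 : ∀ x y : Octonion k, (x * y).2 = y.2 * x.1 + x.2 * y.1.adjugate := fun _ _ => rfl
  simp [TernaryForm.toJ, J.det, Octonion.tr, Octonion.norm, a5, a6, a7, a8,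
    Matrix.det_fin_three, Matrix.adjugate_fin_two]
  rw [e 1 0, e 2 0, e 2 1]; ring

/-- The inclusion of `𝒱` in `V`. -/
def QPair.toV (x : QPair k) : V k := fun i => TernaryForm.toJ (x i)

/-! ### The intersection of two conics -/

/-- The points of the projective plane over `K`. -/
abbrev P2 (K : Type*) [Field K] : Type _ := ℙ K (Fin 3 → K)

/-- The map `P²(K) → P²(L)` that applies a homomorphism of fields to the coordinates. -/
def P2.map {K L : Type*} [Field K] [Field L] (f : K →+* L) : P2 K → P2 L :=
  Projectivization.map (σ := f)
    { toFun := fun v i => f (v i)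
      map_add' := fun v w => funext fun i => map_add f (v i) (w i)
      map_smul' := fun c v => funext fun i => map_mul f c (v i) }
    (fun _ _ h => funext fun i => f.injective (congrFun h i))

/-- The intersection in `P²` over the algebraic closure of the conics defined by `x₁`, `x₂`. -/
def zeroP2 (x : QPair k) : Set (P2 (AlgebraicClosure k)) :=
  {p | ∀ i, p.rep ⬝ᵥ ((x i).1.map (algebraMap k (AlgebraicClosure k)) *ᵥ p.rep) = 0}

variable (k) in
/-- `Gal(kˢᵉᵖ/k)`. -/
abbrev GalSep : Type _ := SeparableClosure k ≃ₐ[k] SeparableClosure k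

/-! ### `H¹` with coefficients in a group with trivial Galois action -/

section H1

variable (Γ : Type*) [Group Γ] [TopologicalSpace Γ]

/-- Continuous homomorphisms from `Γ` to the discrete group `A` (those with open kernel). -/
abbrev ContHom (A : Type*) [Group A] : Type _ := {φ : Γ →* A // IsOpen (φ.ker : Set Γ)}

/-- Conjugacy of homomorphisms. -/
instance conjSetoid (A : Type*) [Group A] : Setoid (ContHom Γ A) where
  r φ ψ := ∃ a : A, ∀ σ, ψ.1 σ = a * φ.1 σ * a⁻¹
  iseqv :=
    { refl := fun φ => ⟨1, fun σ => by simp⟩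
      symm := by
        rintro φ ψ ⟨a, ha⟩
        exact ⟨a⁻¹, fun σ => by rw [ha]; group⟩
      trans := by
        rintro φ ψ χ ⟨a, ha⟩ ⟨b, hb⟩
        exact ⟨b * a, fun σ => by rw [hb, ha]; group⟩ }

/-- `H¹(Γ, A)` for a discrete group `A` with trivial action of `Γ`: continuous homomorphisms
`Γ → A` up to conjugation by elements of `A`. -/
def H1 (A : Type*) [Group A] : Type _ := Quotient (conjSetoid Γ A)

variable {Γ} in
/-- The map on `H¹` induced by a homomorphism of coefficient groups. -/
def H1.map [IsTopologicalGroup Γ] {A B : Type*} [Group A] [Group B] (f : A →* B) :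
    H1 Γ A → H1 Γ B :=
  Quotient.map
    (fun φ => ⟨f.comp φ.1, Subgroup.isOpen_mono
      (fun σ hσ => by
        rw [MonoidHom.mem_ker] at hσ ⊢
        rw [MonoidHom.comp_apply, hσ, map_one]) φ.2⟩)
    (by
      rintro φ ψ ⟨a, ha⟩
      exact ⟨f a, fun σ => by simp [ha]⟩)

end H1

/-- `c` is the class in `H¹(k, 𝔖₄)` corresponding to the pair `x`. That is, for a numbering
`p` of the zero set of `x` by four distinct points with coordinates in `kˢᵉᵖ`, the class `c` is
that of the homomorphism `φ` with `σ(p j) = p (φ σ j)` for all `σ` in the Galois group. -/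
def IsClassOf (x : QPair k) (c : H1 (GalSep k) (Equiv.Perm (Fin 4))) : Prop :=
  ∃ p : Fin 4 → P2 (SeparableClosure k), Function.Injective p ∧
    Set.range (fun j =>
      P2.map (algebraMap (SeparableClosure k) (AlgebraicClosure k)) (p j)) = zeroP2 x ∧
    ∃ φ : ContHom (GalSep k) (Equiv.Perm (Fin 4)),
      (∀ (σ : GalSep k) (j : Fin 4),
        P2.map (σ : SeparableClosure k →+* SeparableClosure k) (p j) = p (φ.1 σ j)) ∧
      c = Quotient.mk _ φ

/-- The class corresponding to `x` does not depend on the numbering of the zero set. -/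
theorem IsClassOf.unique {x : QPair k} {c c' : H1 (GalSep k) (Equiv.Perm (Fin 4))}
    (h : IsClassOf x c) (h' : IsClassOf x c') : c = c' := by
  obtain ⟨p, hp, hr, φ, hφ, rfl⟩ := h
  obtain ⟨q, hq, hs, ψ, hψ, rfl⟩ := h'
  have inj : Function.Injective
      (P2.map (algebraMap (SeparableClosure k) (AlgebraicClosure k))) := by
    intro a b
    induction a using Projectivization.ind with | _ v hv
    induction b using Projectivization.ind with | _ w hw
    intro hab
    obtain ⟨i, hi⟩ := Function.ne_iff.1 hw
    obtain ⟨t, ht⟩ := (Projectivization.mk_eq_mk_iff' _ _ _ _ _).1 hab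
    rw [Projectivization.mk_eq_mk_iff']
    have hti := congrFun ht i
    simp only [Pi.smul_apply, LinearMap.coe_mk, AddHom.coe_mk, smul_eq_mul] at hti
    have hi' : algebraMap (SeparableClosure k) (AlgebraicClosure k) (w i) ≠ 0 := by
      simpa using hi
    have htt : t = algebraMap (SeparableClosure k) (AlgebraicClosure k) (v i / w i) := by
      rw [map_div₀, eq_div_iff hi', hti]
    refine ⟨v i / w i, funext fun j => ?_⟩
    apply (algebraMap (SeparableClosure k) (AlgebraicClosure k)).injective
    have htj := congrFun ht j
    simp only [Pi.smul_apply, LinearMap.coe_mk, AddHom.coe_mk, smul_eq_mul] at htj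
    rw [Pi.smul_apply, smul_eq_mul, map_mul, ← htt, htj]
  have hex : ∀ j, ∃ i, p i = q j := by
    intro j
    have hj : P2.map (algebraMap (SeparableClosure k) (AlgebraicClosure k)) (q j) ∈ zeroP2 x :=
      hs ▸ Set.mem_range_self j
    rw [← hr] at hj
    obtain ⟨i, hi⟩ := hj
    exact ⟨i, inj hi⟩
  choose e he using hex
  have einj : Function.Injective e := fun i j hij => hq (by rw [← he, ← he, hij])
  let E : Equiv.Perm (Fin 4) := Equiv.ofBijective e (Finite.injective_iff_bijective.1 einj)
  refine Quotient.sound ⟨E⁻¹, fun σ => Equiv.ext fun j => ?_⟩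
  apply E.injective
  apply hp
  have h1 : p (E (ψ.1 σ j)) = p (φ.1 σ (E j)) := by
    change p (e (ψ.1 σ j)) = p (φ.1 σ (e j))
    rw [he, ← hψ, ← hφ, he]
  simpa [Equiv.Perm.mul_apply] using h1

/-- The subgroup `𝒮` of `𝔖₄` that fixes the last of the four letters. -/
def S : Subgroup (Equiv.Perm (Fin 4)) := MulAction.stabilizer (Equiv.Perm (Fin 4)) (3 : Fin 4)

end JordanPairs

end

open JordanPairs

/-! It suffices to find in each semistable orbit a pair of conics 2xy + sy² + tz² = 0, 2xz + s'y² +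
t'z² = 0 with t ≠ 0 (`conicPair`). Both pass through the rational point (1:0:0). Eliminating x shows
that the other common points are (-(s + tz²)/2 : 1 : z), where z is a root of tz³ - t'z² + sz - s',
which is F_x(-z, 1). Semistability makes the three roots distinct. Galois permutes them and fixes
the vertex, so the class comes from 𝒮 (`exists_isClassOf_conicPair`).

To reach such a pair, one looks for an isotropic vector common to two octonionic Hermitian forms.
Row operations and octonion multiplications lie in GE₆ and carry every nonsingular element to a
multiple of `base`, so the pair may be taken to be (`base`, Y), and the stabilizer of `base` then
acts on Y. An octonion b of norm zero with tr(b x₂) = -s₁ yields an element of this stabilizer that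
makes the first diagonal entry of Y vanish. The new x₂ is invertible as soon as b is not orthogonal
to a certain vector (`hasIsotropicRow_of_ne_zero`). Isotropic octonions are plentiful enough to meet
both conditions once that vector and x₂ are nonzero; the nonzero discriminant and, in one degenerate
case, the infinitude of k allow this to be arranged (`hasIsotropicRow_of_mem_Vss`).

With x₂ invertible, row operations and triality with trace-zero octonions make the remaining
off-diagonal entries scalar or zero (`HasIsotropicRow.exists_sameOrbit`). -/

noncomputable section

namespace JordanPairs

/-! ### Coordinates on the split octonions -/

section

namespace Octonion

variable {k : Type*}

/-- The octonion with the given eight coordinates. -/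
def ofCoords (a b c d e f g h : k) : Octonion k := (!![a, b; c, d], !![e, f; g, h])

theorem exists_ofCoords (x : Octonion k) :
    ∃ a b c d e f g h, x = ofCoords a b c d e f g h :=
  ⟨_, _, _, _, _, _, _, _, Prod.ext (Matrix.eta_fin_two x.1) (Matrix.eta_fin_two x.2)⟩

theorem ofCoords_inj {a b c d e f g h a' b' c' d' e' f' g' h' : k} :
    ofCoords a b c d e f g h = ofCoords a' b' c' d' e' f' g' h' ↔
      a = a' ∧ b = b' ∧ c = c' ∧ d = d' ∧ e = e' ∧ f = f' ∧ g = g' ∧ h = h' := by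
  constructor
  · intro H
    have h1 := congrArg Prod.fst H
    have h2 := congrArg Prod.snd H
    simp only [ofCoords] at h1 h2
    have e1 := fun i j => congrFun (congrFun h1 i) j
    have e2 := fun i j => congrFun (congrFun h2 i) j
    exact ⟨e1 0 0, e1 0 1, e1 1 0, e1 1 1, e2 0 0, e2 0 1, e2 1 0, e2 1 1⟩
  · rintro ⟨rfl, rfl, rfl, rfl, rfl, rfl, rfl, rfl⟩
    rfl

variable [Field k] (a b c d e f g h a' b' c' d' e' f' g' h' t : k)

theorem add_ofCoords : ofCoords a b c d e f g h + ofCoords a' b' c' d' e' f' g' h' =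
    ofCoords (a + a') (b + b') (c + c') (d + d') (e + e') (f + f') (g + g') (h + h') := by
  refine Prod.ext ?_ ?_
  · change !![a, b; c, d] + !![a', b'; c', d'] = _
    simp [ofCoords]
  · change !![e, f; g, h] + !![e', f'; g', h'] = _
    simp [ofCoords]

theorem neg_ofCoords : -ofCoords a b c d e f g h =
    ofCoords (-a) (-b) (-c) (-d) (-e) (-f) (-g) (-h) := by
  refine Prod.ext ?_ ?_
  · change -!![a, b; c, d] = _
    simp [ofCoords]
  · change -!![e, f; g, h] = _
    simp [ofCoords]

theorem smul_ofCoords : t • ofCoords a b c d e f g h =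
    ofCoords (t * a) (t * b) (t * c) (t * d) (t * e) (t * f) (t * g) (t * h) := by
  refine Prod.ext ?_ ?_
  · change t • !![a, b; c, d] = _
    simp [ofCoords]
  · change t • !![e, f; g, h] = _
    simp [ofCoords]

theorem mul_ofCoords : ofCoords a b c d e f g h * ofCoords a' b' c' d' e' f' g' h' =
    ofCoords (a * a' + b * c' + (h' * e - f' * g)) (a * b' + b * d' + (h' * f - f' * h))
      (c * a' + d * c' + (e' * g - g' * e)) (c * b' + d * d' + (e' * h - g' * f))
      (e' * a + f' * c + (e * d' - f * c')) (e' * b + f' * d + (f * a' - e * b'))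
      (g' * a + h' * c + (g * d' - h * c')) (g' * b + h' * d + (h * a' - g * b')) := by
  refine Prod.ext ?_ ?_
  · change !![a, b; c, d] * !![a', b'; c', d'] + !![e', f'; g', h'].adjugate * !![e, f; g, h] = _
    simp only [Matrix.adjugate_fin_two_of, ofCoords]
    ext i j
    fin_cases i <;> fin_cases j <;> simp <;> ring
  · change !![e', f'; g', h'] * !![a, b; c, d] + !![e, f; g, h] * !![a', b'; c', d'].adjugate = _
    simp only [Matrix.adjugate_fin_two_of, ofCoords]
    ext i j
    fin_cases i <;> fin_cases j <;> simp <;> ring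

theorem conj_ofCoords : conj (ofCoords a b c d e f g h) =
    ofCoords d (-b) (-c) a (-e) (-f) (-g) (-h) := by
  refine Prod.ext ?_ ?_
  · change (!![a, b; c, d]).adjugate = _
    simp [ofCoords, Matrix.adjugate_fin_two_of]
  · change -!![e, f; g, h] = _
    simp [ofCoords]

theorem tr_ofCoords : tr (ofCoords a b c d e f g h) = a + d := by
  simp [tr, ofCoords, Matrix.trace_fin_two]

theorem norm_ofCoords : norm (ofCoords a b c d e f g h) = a * d - b * c - (e * h - f * g) := by
  simp [norm, ofCoords, Matrix.det_fin_two]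

theorem zero_eq_ofCoords : (0 : Octonion k) = ofCoords 0 0 0 0 0 0 0 0 := by
  refine Prod.ext ?_ ?_
  · change (0 : Matrix (Fin 2) (Fin 2) k) = !![0, 0; 0, 0]
    exact (Matrix.eta_fin_two 0)
  · change (0 : Matrix (Fin 2) (Fin 2) k) = !![0, 0; 0, 0]
    exact (Matrix.eta_fin_two 0)

theorem one_eq_ofCoords : (1 : Octonion k) = ofCoords 1 0 0 1 0 0 0 0 := by
  refine Prod.ext ?_ ?_
  · change (1 : Matrix (Fin 2) (Fin 2) k) = !![1, 0; 0, 1]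
    exact Matrix.one_fin_two
  · change (0 : Matrix (Fin 2) (Fin 2) k) = !![0, 0; 0, 0]
    exact (Matrix.eta_fin_two 0)

end Octonion

end

/-! ### Octonion identities: composition, alternativity, Moufang -/

section

namespace Octonion

variable {k : Type*} [Field k]

protected theorem left_distrib (x y z : Octonion k) :
    x * (y + z) = x * y + x * z := by
  obtain ⟨x0, x1, x2, x3, x4, x5, x6, x7, rfl⟩ := exists_ofCoords x
  obtain ⟨y0, y1, y2, y3, y4, y5, y6, y7, rfl⟩ := exists_ofCoords y
  obtain ⟨z0, z1, z2, z3, z4, z5, z6, z7, rfl⟩ := exists_ofCoords z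
  simp only [add_ofCoords, mul_ofCoords, ofCoords_inj]
  refine ⟨?_, ?_, ?_, ?_, ?_, ?_, ?_, ?_⟩ <;> ring

protected theorem right_distrib (x y z : Octonion k) :
    (x + y) * z = x * z + y * z := by
  obtain ⟨x0, x1, x2, x3, x4, x5, x6, x7, rfl⟩ := exists_ofCoords x
  obtain ⟨y0, y1, y2, y3, y4, y5, y6, y7, rfl⟩ := exists_ofCoords y
  obtain ⟨z0, z1, z2, z3, z4, z5, z6, z7, rfl⟩ := exists_ofCoords z
  simp only [add_ofCoords, mul_ofCoords, ofCoords_inj]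
  refine ⟨?_, ?_, ?_, ?_, ?_, ?_, ?_, ?_⟩ <;> ring

protected theorem one_mul (x : Octonion k) :
    1 * x = x := by
  obtain ⟨x0, x1, x2, x3, x4, x5, x6, x7, rfl⟩ := exists_ofCoords x
  simp only [mul_ofCoords, one_eq_ofCoords, ofCoords_inj]
  refine ⟨?_, ?_, ?_, ?_, ?_, ?_, ?_, ?_⟩ <;> ring

protected theorem mul_one (x : Octonion k) :
    x * 1 = x := by
  obtain ⟨x0, x1, x2, x3, x4, x5, x6, x7, rfl⟩ := exists_ofCoords x
  simp only [mul_ofCoords, one_eq_ofCoords, ofCoords_inj]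
  refine ⟨?_, ?_, ?_, ?_, ?_, ?_, ?_, ?_⟩ <;> ring

protected theorem zero_mul (x : Octonion k) :
    0 * x = 0 := by
  obtain ⟨x0, x1, x2, x3, x4, x5, x6, x7, rfl⟩ := exists_ofCoords x
  simp only [mul_ofCoords, zero_eq_ofCoords, ofCoords_inj]
  refine ⟨?_, ?_, ?_, ?_, ?_, ?_, ?_, ?_⟩ <;> ring

protected theorem mul_zero (x : Octonion k) :
    x * 0 = 0 := by
  obtain ⟨x0, x1, x2, x3, x4, x5, x6, x7, rfl⟩ := exists_ofCoords x
  simp only [mul_ofCoords, zero_eq_ofCoords, ofCoords_inj]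
  refine ⟨?_, ?_, ?_, ?_, ?_, ?_, ?_, ?_⟩ <;> ring

instance : NonAssocRing (Octonion k) :=
  { (inferInstance : AddCommGroup (Octonion k)) with
    mul := (· * ·)
    one := 1
    left_distrib := Octonion.left_distrib
    right_distrib := Octonion.right_distrib
    zero_mul := Octonion.zero_mul
    mul_zero := Octonion.mul_zero
    one_mul := Octonion.one_mul
    mul_one := Octonion.mul_one }

protected theorem smul_mul (x y : Octonion k) (t : k) :
    t • x * y = t • (x * y) := by
  obtain ⟨x0, x1, x2, x3, x4, x5, x6, x7, rfl⟩ := exists_ofCoords x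
  obtain ⟨y0, y1, y2, y3, y4, y5, y6, y7, rfl⟩ := exists_ofCoords y
  simp only [smul_ofCoords, mul_ofCoords, ofCoords_inj]
  refine ⟨?_, ?_, ?_, ?_, ?_, ?_, ?_, ?_⟩ <;> ring

theorem mul_smul' (x y : Octonion k) (t : k) :
    x * t • y = t • (x * y) := by
  obtain ⟨x0, x1, x2, x3, x4, x5, x6, x7, rfl⟩ := exists_ofCoords x
  obtain ⟨y0, y1, y2, y3, y4, y5, y6, y7, rfl⟩ := exists_ofCoords y
  simp only [smul_ofCoords, mul_ofCoords, ofCoords_inj]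
  refine ⟨?_, ?_, ?_, ?_, ?_, ?_, ?_, ?_⟩ <;> ring

instance : IsScalarTower k (Octonion k) (Octonion k) := ⟨fun t x y => Octonion.smul_mul x y t⟩

instance : SMulCommClass k (Octonion k) (Octonion k) := ⟨fun t x y => (mul_smul' x y t).symm⟩

instance : FiniteDimensional k (Octonion k) :=
  inferInstanceAs (FiniteDimensional k (Matrix (Fin 2) (Fin 2) k × Matrix (Fin 2) (Fin 2) k))

@[simp]
theorem conj_conj (x : Octonion k) :
    conj (conj x) = x := by
  obtain ⟨x0, x1, x2, x3, x4, x5, x6, x7, rfl⟩ := exists_ofCoords x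
  simp only [conj_ofCoords, ofCoords_inj]
  refine ⟨?_, ?_, ?_, ?_, ?_, ?_, ?_, ?_⟩ <;> first | trivial | ring

@[simp]
theorem conj_add (x y : Octonion k) :
    conj (x + y) = conj x + conj y := by
  obtain ⟨x0, x1, x2, x3, x4, x5, x6, x7, rfl⟩ := exists_ofCoords x
  obtain ⟨y0, y1, y2, y3, y4, y5, y6, y7, rfl⟩ := exists_ofCoords y
  simp only [add_ofCoords, conj_ofCoords, ofCoords_inj]
  refine ⟨?_, ?_, ?_, ?_, ?_, ?_, ?_, ?_⟩ <;> first | trivial | ring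

@[simp]
theorem conj_neg (x : Octonion k) :
    conj (-x) = -conj x := by
  obtain ⟨x0, x1, x2, x3, x4, x5, x6, x7, rfl⟩ := exists_ofCoords x
  simp only [neg_ofCoords, conj_ofCoords]

@[simp]
theorem conj_smul (x : Octonion k) (t : k) :
    conj (t • x) = t • conj x := by
  obtain ⟨x0, x1, x2, x3, x4, x5, x6, x7, rfl⟩ := exists_ofCoords x
  simp only [smul_ofCoords, conj_ofCoords, ofCoords_inj]
  refine ⟨?_, ?_, ?_, ?_, ?_, ?_, ?_, ?_⟩ <;> first | trivial | ring

@[simp]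
protected theorem conj_mul (x y : Octonion k) :
    conj (x * y) = conj y * conj x := by
  obtain ⟨x0, x1, x2, x3, x4, x5, x6, x7, rfl⟩ := exists_ofCoords x
  obtain ⟨y0, y1, y2, y3, y4, y5, y6, y7, rfl⟩ := exists_ofCoords y
  simp only [mul_ofCoords, conj_ofCoords, ofCoords_inj]
  refine ⟨?_, ?_, ?_, ?_, ?_, ?_, ?_, ?_⟩ <;> ring

@[simp]
theorem conj_one : conj (1 : Octonion k) = 1 := by
  simp only [one_eq_ofCoords, conj_ofCoords, neg_zero]

@[simp]
theorem conj_zero : conj (0 : Octonion k) = 0 := by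
  simp only [zero_eq_ofCoords, conj_ofCoords, neg_zero]

@[simp]
theorem tr_one : tr (1 : Octonion k) = 2 := by
  simp only [one_eq_ofCoords, tr_ofCoords, one_add_one_eq_two]

@[simp]
theorem tr_zero : tr (0 : Octonion k) = 0 := by
  simp only [zero_eq_ofCoords, tr_ofCoords, add_zero]

@[simp]
protected theorem norm_one : norm (1 : Octonion k) = 1 := by
  simp only [one_eq_ofCoords, norm_ofCoords]
  ring

@[simp]
protected theorem norm_zero : norm (0 : Octonion k) = 0 := by
  simp only [zero_eq_ofCoords, norm_ofCoords]
  ring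

@[simp]
theorem tr_add (x y : Octonion k) :
    tr (x + y) = tr x + tr y := by
  obtain ⟨x0, x1, x2, x3, x4, x5, x6, x7, rfl⟩ := exists_ofCoords x
  obtain ⟨y0, y1, y2, y3, y4, y5, y6, y7, rfl⟩ := exists_ofCoords y
  simp only [add_ofCoords, tr_ofCoords]
  ring

@[simp]
theorem tr_neg (x : Octonion k) :
    tr (-x) = -tr x := by
  obtain ⟨x0, x1, x2, x3, x4, x5, x6, x7, rfl⟩ := exists_ofCoords x
  simp only [neg_ofCoords, tr_ofCoords]
  ring

@[simp]
theorem tr_smul (x : Octonion k) (t : k) :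
    tr (t • x) = t * tr x := by
  obtain ⟨x0, x1, x2, x3, x4, x5, x6, x7, rfl⟩ := exists_ofCoords x
  simp only [smul_ofCoords, tr_ofCoords]
  ring

@[simp]
theorem tr_conj (x : Octonion k) :
    tr (conj x) = tr x := by
  obtain ⟨x0, x1, x2, x3, x4, x5, x6, x7, rfl⟩ := exists_ofCoords x
  simp only [conj_ofCoords, tr_ofCoords]
  ring

theorem tr_mul_comm (x y : Octonion k) :
    tr (x * y) = tr (y * x) := by
  obtain ⟨x0, x1, x2, x3, x4, x5, x6, x7, rfl⟩ := exists_ofCoords x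
  obtain ⟨y0, y1, y2, y3, y4, y5, y6, y7, rfl⟩ := exists_ofCoords y
  simp only [mul_ofCoords, tr_ofCoords]
  ring

theorem tr_mul_assoc (x y z : Octonion k) :
    tr (x * y * z) = tr (x * (y * z)) := by
  obtain ⟨x0, x1, x2, x3, x4, x5, x6, x7, rfl⟩ := exists_ofCoords x
  obtain ⟨y0, y1, y2, y3, y4, y5, y6, y7, rfl⟩ := exists_ofCoords y
  obtain ⟨z0, z1, z2, z3, z4, z5, z6, z7, rfl⟩ := exists_ofCoords z
  simp only [mul_ofCoords, tr_ofCoords]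
  ring

theorem norm_add (x y : Octonion k) :
    norm (x + y) = norm x + tr (x * conj y) + norm y := by
  obtain ⟨x0, x1, x2, x3, x4, x5, x6, x7, rfl⟩ := exists_ofCoords x
  obtain ⟨y0, y1, y2, y3, y4, y5, y6, y7, rfl⟩ := exists_ofCoords y
  simp only [add_ofCoords, mul_ofCoords, conj_ofCoords, tr_ofCoords, norm_ofCoords]
  ring

@[simp]
protected theorem norm_neg (x : Octonion k) :
    norm (-x) = norm x := by
  obtain ⟨x0, x1, x2, x3, x4, x5, x6, x7, rfl⟩ := exists_ofCoords x
  simp only [neg_ofCoords, norm_ofCoords]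
  ring

@[simp]
protected theorem norm_smul (x : Octonion k) (t : k) :
    norm (t • x) = t ^ 2 * norm x := by
  obtain ⟨x0, x1, x2, x3, x4, x5, x6, x7, rfl⟩ := exists_ofCoords x
  simp only [smul_ofCoords, norm_ofCoords]
  ring

@[simp]
protected theorem norm_conj (x : Octonion k) :
    norm (conj x) = norm x := by
  obtain ⟨x0, x1, x2, x3, x4, x5, x6, x7, rfl⟩ := exists_ofCoords x
  simp only [conj_ofCoords, norm_ofCoords]
  ring

@[simp]
protected theorem norm_mul (x y : Octonion k) :
    norm (x * y) = norm x * norm y := by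
  obtain ⟨x0, x1, x2, x3, x4, x5, x6, x7, rfl⟩ := exists_ofCoords x
  obtain ⟨y0, y1, y2, y3, y4, y5, y6, y7, rfl⟩ := exists_ofCoords y
  simp only [mul_ofCoords, norm_ofCoords]
  ring

theorem conj_eq (x : Octonion k) :
    conj x = tr x • 1 + -x := by
  obtain ⟨x0, x1, x2, x3, x4, x5, x6, x7, rfl⟩ := exists_ofCoords x
  simp only [add_ofCoords, neg_ofCoords, smul_ofCoords, conj_ofCoords, tr_ofCoords, one_eq_ofCoords, ofCoords_inj]
  refine ⟨?_, ?_, ?_, ?_, ?_, ?_, ?_, ?_⟩ <;> ring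

@[simp]
theorem mul_conj_mul (x y : Octonion k) :
    x * (conj x * y) = norm x • y := by
  obtain ⟨x0, x1, x2, x3, x4, x5, x6, x7, rfl⟩ := exists_ofCoords x
  obtain ⟨y0, y1, y2, y3, y4, y5, y6, y7, rfl⟩ := exists_ofCoords y
  simp only [smul_ofCoords, mul_ofCoords, conj_ofCoords, norm_ofCoords, ofCoords_inj]
  refine ⟨?_, ?_, ?_, ?_, ?_, ?_, ?_, ?_⟩ <;> ring

@[simp]
theorem conj_mul_mul (x y : Octonion k) :
    conj x * (x * y) = norm x • y := by
  obtain ⟨x0, x1, x2, x3, x4, x5, x6, x7, rfl⟩ := exists_ofCoords x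
  obtain ⟨y0, y1, y2, y3, y4, y5, y6, y7, rfl⟩ := exists_ofCoords y
  simp only [smul_ofCoords, mul_ofCoords, conj_ofCoords, norm_ofCoords, ofCoords_inj]
  refine ⟨?_, ?_, ?_, ?_, ?_, ?_, ?_, ?_⟩ <;> ring

@[simp]
theorem mul_mul_conj (x y : Octonion k) :
    y * x * conj x = norm x • y := by
  obtain ⟨x0, x1, x2, x3, x4, x5, x6, x7, rfl⟩ := exists_ofCoords x
  obtain ⟨y0, y1, y2, y3, y4, y5, y6, y7, rfl⟩ := exists_ofCoords y
  simp only [smul_ofCoords, mul_ofCoords, conj_ofCoords, norm_ofCoords, ofCoords_inj]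
  refine ⟨?_, ?_, ?_, ?_, ?_, ?_, ?_, ?_⟩ <;> ring

@[simp]
theorem conj_mul_self (x : Octonion k) :
    conj x * x = norm x • 1 := by
  obtain ⟨x0, x1, x2, x3, x4, x5, x6, x7, rfl⟩ := exists_ofCoords x
  simp only [smul_ofCoords, mul_ofCoords, conj_ofCoords, norm_ofCoords, one_eq_ofCoords,
    ofCoords_inj]
  refine ⟨?_, ?_, ?_, ?_, ?_, ?_, ?_, ?_⟩ <;> ring

theorem moufang_mul_conj (b x : Octonion k) :
    b * (conj b * x * conj b) * b = norm b ^ 2 • x := by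
  obtain ⟨b0, b1, b2, b3, b4, b5, b6, b7, rfl⟩ := exists_ofCoords b
  obtain ⟨x0, x1, x2, x3, x4, x5, x6, x7, rfl⟩ := exists_ofCoords x
  simp only [smul_ofCoords, mul_ofCoords, conj_ofCoords, norm_ofCoords, ofCoords_inj]
  refine ⟨?_, ?_, ?_, ?_, ?_, ?_, ?_, ?_⟩ <;> ring

theorem conj_moufang_mul (b x : Octonion k) :
    conj b * (b * x * b) * conj b = norm b ^ 2 • x := by
  obtain ⟨b0, b1, b2, b3, b4, b5, b6, b7, rfl⟩ := exists_ofCoords b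
  obtain ⟨x0, x1, x2, x3, x4, x5, x6, x7, rfl⟩ := exists_ofCoords x
  simp only [smul_ofCoords, mul_ofCoords, conj_ofCoords, norm_ofCoords, ofCoords_inj]
  refine ⟨?_, ?_, ?_, ?_, ?_, ?_, ?_, ?_⟩ <;> ring

/-- For `x` of norm zero this collapses `x * y * x` to a multiple of `x`; for `y = 1` it is the
quadratic equation of `x`. -/
theorem mul_mul_self (x y : Octonion k) :
    x * y * x = tr (x * y) • x + -(norm x • conj y) := by
  obtain ⟨x0, x1, x2, x3, x4, x5, x6, x7, rfl⟩ := exists_ofCoords x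
  obtain ⟨y0, y1, y2, y3, y4, y5, y6, y7, rfl⟩ := exists_ofCoords y
  simp only [add_ofCoords, neg_ofCoords, smul_ofCoords, mul_ofCoords, conj_ofCoords, tr_ofCoords, norm_ofCoords,
    ofCoords_inj]
  refine ⟨?_, ?_, ?_, ?_, ?_, ?_, ?_, ?_⟩ <;> ring

/-- The Moufang identity gathers the outer factors `b` around `x * y`. Cyclicity of the trace then
brings the two factors `conj b` next to them, and the norms come out. -/
theorem tr_moufang (b x y z : Octonion k) :
    tr (b * x * (y * b) * (conj b * z * conj b)) = norm b ^ 2 * tr (x * y * z) := by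
  have h : b * x * (y * b) = b * (x * y) * b := by
    obtain ⟨b0, b1, b2, b3, b4, b5, b6, b7, rfl⟩ := exists_ofCoords b
    obtain ⟨x0, x1, x2, x3, x4, x5, x6, x7, rfl⟩ := exists_ofCoords x
    obtain ⟨y0, y1, y2, y3, y4, y5, y6, y7, rfl⟩ := exists_ofCoords y
    simp only [mul_ofCoords, ofCoords_inj]
    refine ⟨?_, ?_, ?_, ?_, ?_, ?_, ?_, ?_⟩ <;> ring
  rw [h, ← tr_mul_assoc, tr_mul_comm, ← tr_mul_assoc, ← tr_mul_assoc, conj_moufang_mul,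
    smul_mul_assoc, tr_smul]

end Octonion

end

/-! ### Explicit elements of GE₆ -/

section

variable {k : Type*}

open Octonion

namespace J

/-- The Hermitian matrix with rows `(s₁, x₃, conj x₂)`, `(conj x₃, s₂, x₁)`, `(x₂, conj x₁, s₃)`. -/
def mk (s₁ s₂ s₃ : k) (x₁ x₂ x₃ : Octonion k) : J k := (![s₁, s₂, s₃], ![x₁, x₂, x₃])

theorem exists_mk (X : J k) : ∃ s₁ s₂ s₃ x₁ x₂ x₃, X = mk s₁ s₂ s₃ x₁ x₂ x₃ :=
  ⟨X.1 0, X.1 1, X.1 2, X.2 0, X.2 1, X.2 2, Prod.ext (List.ofFn_inj.1 rfl) (List.ofFn_inj.1 rfl)⟩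

theorem mk_inj {s₁ s₂ s₃ t₁ t₂ t₃ : k} {x₁ x₂ x₃ y₁ y₂ y₃ : Octonion k} :
    mk s₁ s₂ s₃ x₁ x₂ x₃ = mk t₁ t₂ t₃ y₁ y₂ y₃ ↔
      (s₁ = t₁ ∧ s₂ = t₂ ∧ s₃ = t₃) ∧ x₁ = y₁ ∧ x₂ = y₂ ∧ x₃ = y₃ := by
  simp [mk]

/-- The map on `J` given by a formula in the entries. -/
def onEntries (F : k → k → k → Octonion k → Octonion k → Octonion k → J k) (X : J k) : J k :=
  F (X.1 0) (X.1 1) (X.1 2) (X.2 0) (X.2 1) (X.2 2)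

theorem onEntries_mk (F : k → k → k → Octonion k → Octonion k → Octonion k → J k)
    (s₁ s₂ s₃ : k) (x₁ x₂ x₃ : Octonion k) :
    onEntries F (mk s₁ s₂ s₃ x₁ x₂ x₃) = F s₁ s₂ s₃ x₁ x₂ x₃ := rfl

variable [Field k]

theorem mk_add (s₁ s₂ s₃ t₁ t₂ t₃ : k) (x₁ x₂ x₃ y₁ y₂ y₃ : Octonion k) :
    mk s₁ s₂ s₃ x₁ x₂ x₃ + mk t₁ t₂ t₃ y₁ y₂ y₃ =
      mk (s₁ + t₁) (s₂ + t₂) (s₃ + t₃) (x₁ + y₁) (x₂ + y₂) (x₃ + y₃) := by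
  simp [mk]

theorem smul_mk (c s₁ s₂ s₃ : k) (x₁ x₂ x₃ : Octonion k) :
    c • mk s₁ s₂ s₃ x₁ x₂ x₃ = mk (c * s₁) (c * s₂) (c * s₃) (c • x₁) (c • x₂) (c • x₃) := by
  simp [mk]

theorem det_mk (s₁ s₂ s₃ : k) (x₁ x₂ x₃ : Octonion k) :
    det (mk s₁ s₂ s₃ x₁ x₂ x₃) =
      s₁ * s₂ * s₃ + (x₁ * x₂ * x₃).tr - s₁ * x₁.norm - s₂ * x₂.norm - s₃ * x₃.norm := rfl

/-- A map given by a formula in the entries is realized by an element of `GE₆` if it is linear,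
multiplies the determinant by a unit and has a left inverse. -/
theorem exists_GE6 (F : k → k → k → Octonion k → Octonion k → Octonion k → J k) (g : J k → J k)
    (hadd : ∀ s₁ s₂ s₃ x₁ x₂ x₃ t₁ t₂ t₃ y₁ y₂ y₃,
      F (s₁ + t₁) (s₂ + t₂) (s₃ + t₃) (x₁ + y₁) (x₂ + y₂) (x₃ + y₃) =
        F s₁ s₂ s₃ x₁ x₂ x₃ + F t₁ t₂ t₃ y₁ y₂ y₃)
    (hsmul : ∀ c s₁ s₂ s₃ x₁ x₂ x₃,
      F (c * s₁) (c * s₂) (c * s₃) (c • x₁) (c • x₂) (c • x₃) = c • F s₁ s₂ s₃ x₁ x₂ x₃)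
    (hinv : ∀ s₁ s₂ s₃ x₁ x₂ x₃, g (F s₁ s₂ s₃ x₁ x₂ x₃) = mk s₁ s₂ s₃ x₁ x₂ x₃)
    {c : k} (hc : c ≠ 0)
    (hdet : ∀ s₁ s₂ s₃ x₁ x₂ x₃,
      det (F s₁ s₂ s₃ x₁ x₂ x₃) = c * det (mk s₁ s₂ s₃ x₁ x₂ x₃)) :
    ∃ h : GE6 k, ∀ s₁ s₂ s₃ x₁ x₂ x₃,
      (h : J k ≃ₗ[k] J k) (mk s₁ s₂ s₃ x₁ x₂ x₃) = F s₁ s₂ s₃ x₁ x₂ x₃ := by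
  let l : J k →ₗ[k] J k :=
    { toFun := onEntries F
      map_add' := fun X Y => hadd _ _ _ _ _ _ _ _ _ _ _ _
      map_smul' := fun c X => hsmul _ _ _ _ _ _ _ }
  have hX : ∀ X : J k, g (l X) = X := fun X => by
    obtain ⟨s₁, s₂, s₃, x₁, x₂, x₃, rfl⟩ := exists_mk X
    exact hinv _ _ _ _ _ _
  -- A left inverse gives injectivity, which is enough in finite dimension.
  have hl : Function.Injective l := fun X Y h => by
    rw [← hX X, ← hX Y]
    exact congrArg g h
  refine ⟨⟨LinearEquiv.ofInjectiveEndo l hl, Units.mk0 c hc, fun X => ?_⟩, fun _ _ _ _ _ _ => rfl⟩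
  obtain ⟨s₁, s₂, s₃, x₁, x₂, x₃, rfl⟩ := exists_mk X
  exact hdet _ _ _ _ _ _

/-- Add `a` times the second row to the first, and `conj a` times the second column to the first. -/
theorem exists_add_row₁₂ (a : Octonion k) : ∃ h : GE6 k, ∀ s₁ s₂ s₃ x₁ x₂ x₃,
    (h : J k ≃ₗ[k] J k) (mk s₁ s₂ s₃ x₁ x₂ x₃) =
      mk (s₁ + tr (a * conj x₃) + a.norm * s₂) s₂ s₃ x₁ (x₂ + conj x₁ * conj a) (x₃ + s₂ • a) := by
  refine exists_GE6 _ (onEntries fun s₁ s₂ s₃ x₁ x₂ x₃ =>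
      mk (s₁ + tr (-a * conj x₃) + (-a).norm * s₂) s₂ s₃ x₁ (x₂ + conj x₁ * conj (-a))
        (x₃ + s₂ • -a)) ?_ ?_ ?_ one_ne_zero ?_
  · intros
    simp only [mk_add, mk_inj, conj_add, mul_add, add_mul, tr_add, add_smul]
    refine ⟨⟨?_, trivial, trivial⟩, trivial, ?_, ?_⟩
    · ring
    · abel
    · abel
  · intros
    simp only [smul_mk, mk_inj, conj_smul, mul_smul_comm, smul_mul_assoc, tr_smul, smul_add,
      smul_smul]
    refine ⟨⟨?_, trivial, trivial⟩, trivial, trivial, trivial⟩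
    ring
  · intros
    rw [onEntries_mk, mk_inj]
    refine ⟨⟨?_, rfl, rfl⟩, rfl, ?_, ?_⟩
    · simp only [conj_add, conj_smul, mul_add, mul_smul_comm, neg_mul, mul_conj, tr_add, tr_smul,
        tr_neg, Octonion.norm_neg, smul_neg, tr_one]
      ring
    · simp
    · simp
  · intro s₁ s₂ s₃ x₁ x₂ x₃
    simp only [det_mk, mul_add, add_mul, mul_conj_mul, norm_add, tr_add, tr_smul, smul_mul_assoc,
      mul_smul_comm, Octonion.norm_smul, Octonion.norm_mul, Octonion.norm_conj, Octonion.conj_mul,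
      conj_smul, conj_conj, conj_mul_self, tr_one]
    -- Cyclicity and conjugation invariance of the trace identify the mixed traces, after which all
    -- terms in `a` cancel.
    rw [tr_mul_comm (x₁ * x₂) a, ← tr_mul_assoc x₂ a x₁, tr_mul_comm (x₂ * a) x₁,
      tr_mul_comm a (x₁ * x₂), tr_mul_assoc x₁ x₂ a,
      tr_mul_comm (conj a) x₃, ← tr_conj (x₃ * conj a), Octonion.conj_mul, conj_conj]
    ring

/-- The cyclic permutation of the rows and columns. -/
theorem exists_rotate : ∃ h : GE6 k, ∀ s₁ s₂ s₃ x₁ x₂ x₃,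
    (h : J k ≃ₗ[k] J k) (mk s₁ s₂ s₃ x₁ x₂ x₃) = mk s₂ s₃ s₁ x₂ x₃ x₁ := by
  refine exists_GE6 _ (onEntries fun s₁ s₂ s₃ x₁ x₂ x₃ => mk s₃ s₁ s₂ x₃ x₁ x₂)
    (fun _ _ _ _ _ _ _ _ _ _ _ _ => (mk_add ..).symm) (fun _ _ _ _ _ _ _ => (smul_mk ..).symm)
    (fun _ _ _ _ _ _ => rfl) one_ne_zero fun s₁ s₂ s₃ x₁ x₂ x₃ => ?_
  rw [det_mk, det_mk, tr_mul_comm (x₂ * x₃), ← tr_mul_assoc]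
  ring

/-- The transposition of the first two rows and columns. -/
theorem exists_swap : ∃ h : GE6 k, ∀ s₁ s₂ s₃ x₁ x₂ x₃,
    (h : J k ≃ₗ[k] J k) (mk s₁ s₂ s₃ x₁ x₂ x₃) =
      mk s₂ s₁ s₃ (conj x₂) (conj x₁) (conj x₃) := by
  refine exists_GE6 _
    (onEntries fun s₁ s₂ s₃ x₁ x₂ x₃ => mk s₂ s₁ s₃ (conj x₂) (conj x₁) (conj x₃))
    (fun _ _ _ _ _ _ _ _ _ _ _ _ => by simp [mk_add]) (fun _ _ _ _ _ _ _ => by simp [smul_mk])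
    (fun _ _ _ _ _ _ => by simp [onEntries_mk]) one_ne_zero fun s₁ s₂ s₃ x₁ x₂ x₃ => ?_
  rw [det_mk, det_mk, Octonion.norm_conj, Octonion.norm_conj, Octonion.norm_conj,
    ← Octonion.conj_mul, tr_mul_comm, ← Octonion.conj_mul, tr_conj]
  ring

/-- The similitude of the determinant given by left, right and two-sided multiplication. -/
theorem exists_triality (b : Octonion k) (hb : b.norm ≠ 0) : ∃ h : GE6 k, ∀ s₁ s₂ s₃ x₁ x₂ x₃,
    (h : J k ≃ₗ[k] J k) (mk s₁ s₂ s₃ x₁ x₂ x₃) =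
      mk (b.norm * s₁) (b.norm * s₂) s₃ (b * x₁) (x₂ * b) (conj b * x₃ * conj b) := by
  refine exists_GE6 _ (onEntries fun s₁ s₂ s₃ x₁ x₂ x₃ =>
      mk (b.norm⁻¹ * s₁) (b.norm⁻¹ * s₂) s₃ (b.norm⁻¹ • (conj b * x₁)) (b.norm⁻¹ • (x₂ * conj b))
        ((b.norm ^ 2)⁻¹ • (b * x₃ * b)))
    (fun _ _ _ _ _ _ _ _ _ _ _ _ => by simp only [mk_add, mul_add, add_mul])
    (fun _ _ _ _ _ _ _ => by simp only [smul_mk, mul_left_comm, mul_smul_comm, smul_mul_assoc])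
    (fun _ _ _ _ _ _ => ?_) (pow_ne_zero 2 hb) fun s₁ s₂ s₃ x₁ x₂ x₃ => ?_
  · rw [onEntries_mk, conj_mul_mul, mul_mul_conj, moufang_mul_conj, inv_smul_smul₀ hb,
      inv_smul_smul₀ hb, inv_smul_smul₀ (pow_ne_zero 2 hb), inv_mul_cancel_left₀ hb,
      inv_mul_cancel_left₀ hb]
  · rw [det_mk, det_mk, tr_moufang]
    simp only [Octonion.norm_mul, Octonion.norm_conj]
    ring

/-- Rescaling of the rows and columns. -/
theorem exists_torus (l₁ l₂ l₃ : k) (h₁ : l₁ ≠ 0) (h₂ : l₂ ≠ 0) (h₃ : l₃ ≠ 0) :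
    ∃ h : GE6 k, ∀ s₁ s₂ s₃ x₁ x₂ x₃, (h : J k ≃ₗ[k] J k) (mk s₁ s₂ s₃ x₁ x₂ x₃) =
      mk (l₁ ^ 2 * s₁) (l₂ ^ 2 * s₂) (l₃ ^ 2 * s₃) ((l₂ * l₃) • x₁) ((l₃ * l₁) • x₂)
        ((l₁ * l₂) • x₃) := by
  refine exists_GE6 _ (onEntries fun s₁ s₂ s₃ x₁ x₂ x₃ =>
      mk ((l₁ ^ 2)⁻¹ * s₁) ((l₂ ^ 2)⁻¹ * s₂) ((l₃ ^ 2)⁻¹ * s₃) ((l₂ * l₃)⁻¹ • x₁)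
        ((l₃ * l₁)⁻¹ • x₂) ((l₁ * l₂)⁻¹ • x₃))
    (fun _ _ _ _ _ _ _ _ _ _ _ _ => by simp only [mk_add, mul_add, smul_add])
    (fun c _ _ _ _ _ _ => by simp only [smul_mk, mul_left_comm c, smul_smul, mul_comm _ c])
    (fun _ _ _ _ _ _ => ?_) (c := (l₁ * l₂ * l₃) ^ 2)
    (pow_ne_zero 2 (mul_ne_zero (mul_ne_zero h₁ h₂) h₃)) fun s₁ s₂ s₃ x₁ x₂ x₃ => ?_
  · rw [onEntries_mk, inv_smul_smul₀ (mul_ne_zero h₂ h₃), inv_smul_smul₀ (mul_ne_zero h₃ h₁),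
      inv_smul_smul₀ (mul_ne_zero h₁ h₂), inv_mul_cancel_left₀ (pow_ne_zero 2 h₁),
      inv_mul_cancel_left₀ (pow_ne_zero 2 h₂), inv_mul_cancel_left₀ (pow_ne_zero 2 h₃)]
  · simp only [det_mk, Octonion.norm_smul, smul_mul_assoc, mul_smul_comm, tr_smul]
    ring

end J

end

section

variable {k : Type*} [Field k]

open Octonion J

/-! ### Row operations -/

namespace J

/-- Conjugation by `exists_swap` and `exists_rotate` carries `exists_add_row₁₂` to every other pair
of rows; here and in the next four lemmas only the permutation changes. -/
theorem exists_add_row₂₁ (a : Octonion k) : ∃ h : GE6 k, ∀ s₁ s₂ s₃ x₁ x₂ x₃,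
    (h : J k ≃ₗ[k] J k) (mk s₁ s₂ s₃ x₁ x₂ x₃) =
      mk s₁ (s₂ + tr (a * x₃) + a.norm * s₁) s₃ (x₁ + a * conj x₂) x₂ (x₃ + s₁ • conj a) := by
  obtain ⟨h, hh⟩ := exists_add_row₁₂ a
  obtain ⟨r, hr⟩ := exists_swap (k := k)
  refine ⟨r * h * r, fun s₁ s₂ s₃ x₁ x₂ x₃ => ?_⟩
  simp only [Subgroup.coe_mul, LinearEquiv.mul_apply, hr, hh]
  simp

theorem exists_add_row₂₃ (a : Octonion k) : ∃ h : GE6 k, ∀ s₁ s₂ s₃ x₁ x₂ x₃,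
    (h : J k ≃ₗ[k] J k) (mk s₁ s₂ s₃ x₁ x₂ x₃) =
      mk s₁ (s₂ + tr (a * conj x₁) + a.norm * s₃) s₃ (x₁ + s₃ • a) x₂
        (x₃ + conj x₂ * conj a) := by
  obtain ⟨h, hh⟩ := exists_add_row₁₂ a
  obtain ⟨r, hr⟩ := exists_rotate (k := k)
  refine ⟨r * r * h * r, fun s₁ s₂ s₃ x₁ x₂ x₃ => ?_⟩
  simp only [Subgroup.coe_mul, LinearEquiv.mul_apply, hr, hh]

theorem exists_add_row₃₁ (a : Octonion k) : ∃ h : GE6 k, ∀ s₁ s₂ s₃ x₁ x₂ x₃,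
    (h : J k ≃ₗ[k] J k) (mk s₁ s₂ s₃ x₁ x₂ x₃) =
      mk s₁ s₂ (s₃ + tr (a * conj x₂) + a.norm * s₁) (x₁ + conj x₃ * conj a) (x₂ + s₁ • a)
        x₃ := by
  obtain ⟨h, hh⟩ := exists_add_row₁₂ a
  obtain ⟨r, hr⟩ := exists_rotate (k := k)
  refine ⟨r * h * r * r, fun s₁ s₂ s₃ x₁ x₂ x₃ => ?_⟩
  simp only [Subgroup.coe_mul, LinearEquiv.mul_apply, hr, hh]

theorem exists_add_row₃₂ (a : Octonion k) : ∃ h : GE6 k, ∀ s₁ s₂ s₃ x₁ x₂ x₃,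
    (h : J k ≃ₗ[k] J k) (mk s₁ s₂ s₃ x₁ x₂ x₃) =
      mk s₁ s₂ (s₃ + tr (a * x₁) + a.norm * s₂) (x₁ + s₂ • conj a) (x₂ + a * conj x₃) x₃ := by
  obtain ⟨h, hh⟩ := exists_add_row₂₁ a
  obtain ⟨r, hr⟩ := exists_rotate (k := k)
  refine ⟨r * r * h * r, fun s₁ s₂ s₃ x₁ x₂ x₃ => ?_⟩
  simp only [Subgroup.coe_mul, LinearEquiv.mul_apply, hr, hh]

theorem exists_add_row₁₃ (a : Octonion k) : ∃ h : GE6 k, ∀ s₁ s₂ s₃ x₁ x₂ x₃,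
    (h : J k ≃ₗ[k] J k) (mk s₁ s₂ s₃ x₁ x₂ x₃) =
      mk (s₁ + tr (a * x₂) + a.norm * s₃) s₂ s₃ x₁ (x₂ + s₃ • conj a) (x₃ + a * conj x₁) := by
  obtain ⟨h, hh⟩ := exists_add_row₂₁ a
  obtain ⟨r, hr⟩ := exists_rotate (k := k)
  refine ⟨r * h * r * r, fun s₁ s₂ s₃ x₁ x₂ x₃ => ?_⟩
  simp only [Subgroup.coe_mul, LinearEquiv.mul_apply, hr, hh]

/-- The determinant is a cubic form. -/
theorem exists_det_smul_add_smul (X Y : J k) : ∃ p q : k, ∀ u v : k,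
    det (u • X + v • Y) =
      det X * u ^ 3 + p * u ^ 2 * v + q * u * v ^ 2 + det Y * v ^ 3 := by
  obtain ⟨s₁, s₂, s₃, x₁, x₂, x₃, rfl⟩ := exists_mk X
  obtain ⟨t₁, t₂, t₃, y₁, y₂, y₃, rfl⟩ := exists_mk Y
  refine ⟨t₁ * s₂ * s₃ + s₁ * t₂ * s₃ + s₁ * s₂ * t₃ + tr (y₁ * x₂ * x₃) + tr (x₁ * y₂ * x₃) +
      tr (x₁ * x₂ * y₃) - t₁ * x₁.norm - t₂ * x₂.norm - t₃ * x₃.norm - s₁ * tr (x₁ * conj y₁) -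
      s₂ * tr (x₂ * conj y₂) - s₃ * tr (x₃ * conj y₃),
    s₁ * t₂ * t₃ + t₁ * s₂ * t₃ + t₁ * t₂ * s₃ + tr (x₁ * y₂ * y₃) + tr (y₁ * x₂ * y₃) +
      tr (y₁ * y₂ * x₃) - s₁ * y₁.norm - s₂ * y₂.norm - s₃ * y₃.norm - t₁ * tr (x₁ * conj y₁) -
      t₂ * tr (x₂ * conj y₂) - t₃ * tr (x₃ * conj y₃), fun u v => ?_⟩
  simp only [smul_mk, mk_add, det_mk, norm_add, Octonion.norm_smul, conj_smul, mul_smul_comm,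
    smul_mul_assoc, tr_smul, mul_add, add_mul, tr_add]
  ring

end J

/-! ### Orbits and the discriminant -/

/-- The points `x` and `y` are in the same orbit of `G`. -/
def SameOrbit (x y : V k) : Prop := y ∈ MulAction.orbit (G k) x

namespace SameOrbit

theorem refl (x : V k) : SameOrbit x x := MulAction.mem_orbit_self x

theorem trans {x y z : V k} (h : SameOrbit x y) (h' : SameOrbit y z) : SameOrbit x z := by
  obtain ⟨g, rfl⟩ := h
  obtain ⟨g', rfl⟩ := h'
  exact ⟨g' * g, mul_smul _ _ _⟩

theorem of_GE6 (h : GE6 k) (X Y : J k) :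
    SameOrbit ![X, Y] ![(h : J k ≃ₗ[k] J k) X, (h : J k ≃ₗ[k] J k) Y] := by
  refine ⟨(h, 1), funext fun i => ?_⟩
  change ∑ j, (1 : Matrix (Fin 2) (Fin 2) k) i j • (h : J k ≃ₗ[k] J k) (![X, Y] j) = _
  fin_cases i <;> simp [Matrix.one_apply]

theorem of_GL (a b c d : k) (h : a * d - b * c ≠ 0) (X Y : J k) :
    SameOrbit ![X, Y] ![a • X + b • Y, c • X + d • Y] := by
  refine ⟨(1, Matrix.GeneralLinearGroup.mkOfDetNeZero !![a, b; c, d]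
    (by rwa [Matrix.det_fin_two_of])), funext fun i => ?_⟩
  change ∑ j, !![a, b; c, d] i j • ![X, Y] j = _
  fin_cases i <;> simp

theorem add_smul (c : k) (X Y : J k) : SameOrbit ![X, Y] ![X, Y + c • X] := by
  simpa [add_comm] using of_GL 1 0 c 1 (by simp) X Y

theorem smul_left {c : k} (h : c ≠ 0) (X Y : J k) : SameOrbit ![X, Y] ![c • X, Y] := by
  simpa using of_GL c 0 0 1 (by simpa) X Y

theorem smul_right {c : k} (h : c ≠ 0) (X Y : J k) : SameOrbit ![X, Y] ![X, c • Y] := by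
  simpa using of_GL 1 0 0 c (by simpa) X Y

end SameOrbit

/-- The values at (1, 1) and (1, -1) determine the two middle coefficients because 2 is invertible.
-/
theorem binaryCubic_eq (h2 : (2 : k) ≠ 0) {x : V k} {p q : k}
    (h : ∀ u v : k, J.det (u • x 0 + v • x 1) =
      J.det (x 0) * u ^ 3 + p * u ^ 2 * v + q * u * v ^ 2 + J.det (x 1) * v ^ 3) :
    binaryCubic J.det x = ⟨J.det (x 0), p, q, J.det (x 1)⟩ := by
  have h₁ := h 1 1
  have h₂ := h 1 (-1)
  rw [one_smul, one_smul] at h₁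
  rw [one_smul, neg_one_smul, ← sub_eq_add_neg] at h₂
  refine Cubic.ext rfl ?_ ?_ rfl
  · change (J.det (x 0 + x 1) - J.det (x 0 - x 1)) / 2 - J.det (x 1) = p
    rw [h₁, h₂]
    field_simp
    ring
  · change (J.det (x 0 + x 1) + J.det (x 0 - x 1)) / 2 - J.det (x 0) = q
    rw [h₁, h₂]
    field_simp
    ring

/-- The set of semi-stable points is stable under the group. -/
theorem SameOrbit.mem_Vss (h2 : (2 : k) ≠ 0) {x y : V k} (h : SameOrbit x y)
    (hx : x ∈ Vss k) : y ∈ Vss k := by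
  obtain ⟨⟨⟨g, c, hg⟩, A⟩, rfl⟩ := h
  obtain ⟨p, q, hpq⟩ := J.exists_det_smul_add_smul (x 0) (x 1)
  have hA : A.1 0 0 * A.1 1 1 - A.1 0 1 * A.1 1 0 ≠ 0 := by
    rw [← Matrix.det_fin_two]
    exact A.det_ne_zero
  have hy : ∀ i, ((((⟨g, c, hg⟩ : GE6 k), A) : G k) • x) i = g (A.1 i 0 • x 0 + A.1 i 1 • x 1) := by
    intro i
    change ∑ j, A.1 i j • g (x j) = _
    simp [Fin.sum_univ_two]
  set y : V k := (((⟨g, c, hg⟩ : GE6 k), A) : G k) • x with hydef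
  have hdet : ∀ u v : k, J.det (u • y 0 + v • y 1) =
      c * (J.det (x 0) * (u * A.1 0 0 + v * A.1 1 0) ^ 3 +
        p * (u * A.1 0 0 + v * A.1 1 0) ^ 2 * (u * A.1 0 1 + v * A.1 1 1) +
        q * (u * A.1 0 0 + v * A.1 1 0) * (u * A.1 0 1 + v * A.1 1 1) ^ 2 +
        J.det (x 1) * (u * A.1 0 1 + v * A.1 1 1) ^ 3) := by
    intro u v
    rw [← hpq, ← hg, hy, hy, ← map_smul, ← map_smul, ← map_add]
    congr 2
    module
  have h0 := hdet 1 0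
  have h1 := hdet 0 1
  simp only [one_smul, zero_smul, add_zero, zero_add, zero_mul, one_mul] at h0 h1
  have hy' := binaryCubic_eq h2 (x := y)
    (p := c * (3 * J.det (x 0) * A.1 0 0 ^ 2 * A.1 1 0 +
      p * (2 * A.1 0 0 * A.1 1 0 * A.1 0 1 + A.1 0 0 ^ 2 * A.1 1 1) +
      q * (A.1 1 0 * A.1 0 1 ^ 2 + 2 * A.1 0 0 * A.1 0 1 * A.1 1 1) +
      3 * J.det (x 1) * A.1 0 1 ^ 2 * A.1 1 1))
    (q := c * (3 * J.det (x 0) * A.1 0 0 * A.1 1 0 ^ 2 +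
      p * (2 * A.1 0 0 * A.1 1 0 * A.1 1 1 + A.1 1 0 ^ 2 * A.1 0 1) +
      q * (A.1 0 0 * A.1 1 1 ^ 2 + 2 * A.1 1 0 * A.1 0 1 * A.1 1 1) +
      3 * J.det (x 1) * A.1 0 1 * A.1 1 1 ^ 2))
    (fun u v => by rw [hdet, h0, h1]; ring)
  have hx' := binaryCubic_eq h2 hpq
  simp only [Vss, Set.mem_ofPred_eq] at hx ⊢
  rw [hx'] at hx
  rw [hy', h0, h1]
  -- The new cubic is `c` times the old one after a linear substitution; the discriminant has degree
  -- 4 in the coefficients and weight 6 in the determinant of the substitution.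
  have : (c : k) ^ 4 * (A.1 0 0 * A.1 1 1 - A.1 0 1 * A.1 1 0) ^ 6 *
      Cubic.discr ⟨J.det (x 0), p, q, J.det (x 1)⟩ ≠ 0 :=
    mul_ne_zero (mul_ne_zero (pow_ne_zero _ c.ne_zero) (pow_ne_zero _ hA)) hx
  convert this using 1
  simp only [Cubic.discr]
  ring

/-- In the orbit of a semi-stable point there is a pair whose first entry is nonsingular. -/
theorem exists_sameOrbit_det_ne_zero {x : V k} (hx : x ∈ Vss k) :
    ∃ X Y : J k, SameOrbit x ![X, Y] ∧ J.det X ≠ 0 := by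
  have hxx : x = ![x 0, x 1] := List.ofFn_inj.1 rfl
  by_contra! H
  -- A nonzero row (a, b) completes to an invertible matrix, so each such combination is the first
  -- entry of a pair in the orbit. Four of these values already determine `binaryCubic`.
  have H' : ∀ a b : k, a ≠ 0 ∨ b ≠ 0 → J.det (a • x 0 + b • x 1) = 0 := by
    intro a b hab
    rcases hab with h | h
    · refine H _ (0 • x 0 + 1 • x 1) ?_
      conv_lhs => rw [hxx]
      exact_mod_cast SameOrbit.of_GL a b 0 1 (by simpa) (x 0) (x 1)
    · refine H _ (1 • x 0 + 0 • x 1) ?_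
      conv_lhs => rw [hxx]
      exact_mod_cast SameOrbit.of_GL a b 1 0 (by simpa) (x 0) (x 1)
  have e1 := H' 1 0 (by simp)
  have e2 := H' 0 1 (by simp)
  have e3 := H' 1 1 (by simp)
  have e4 := H' 1 (-1) (by simp)
  simp only [one_smul, zero_smul, add_zero, zero_add, neg_smul, ← sub_eq_add_neg] at e1 e2 e3 e4
  refine hx ?_
  simp [binaryCubic, Cubic.discr, e1, e2, e3, e4]

end

/-! ### The trace form and isotropic octonions -/

section

variable {k : Type*} [Field k]

namespace Octonion

theorem exists_tr_mul_ne_zero {u : Octonion k} (hu : u ≠ 0) : ∃ x, tr (x * u) ≠ 0 := by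
  obtain ⟨a, b, c, d, e, f, g, h, rfl⟩ := exists_ofCoords u
  by_contra! H
  apply hu
  have h1 := H (ofCoords 1 0 0 0 0 0 0 0)
  have h2 := H (ofCoords 0 0 1 0 0 0 0 0)
  have h3 := H (ofCoords 0 1 0 0 0 0 0 0)
  have h4 := H (ofCoords 0 0 0 1 0 0 0 0)
  have h5 := H (ofCoords 0 0 0 0 0 0 0 1)
  have h6 := H (ofCoords 0 0 0 0 0 0 1 0)
  have h7 := H (ofCoords 0 0 0 0 0 1 0 0)
  have h8 := H (ofCoords 0 0 0 0 1 0 0 0)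
  simp only [mul_ofCoords, tr_ofCoords, zero_mul, mul_zero, one_mul, mul_one, add_zero, zero_add,
    sub_zero, zero_sub, sub_self, neg_eq_zero] at h1 h2 h3 h4 h5 h6 h7 h8
  rw [zero_eq_ofCoords, ofCoords_inj]
  exact ⟨h1, h2, h3, h4, h5, h6, h7, h8⟩

theorem exists_tr_mul_ne_zero₂ {u v : Octonion k} (hu : u ≠ 0) (hv : v ≠ 0) :
    ∃ x, tr (x * u) ≠ 0 ∧ tr (x * v) ≠ 0 := by
  obtain ⟨x, hx⟩ := exists_tr_mul_ne_zero hu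
  obtain ⟨y, hy⟩ := exists_tr_mul_ne_zero hv
  by_cases hxv : tr (x * v) = 0
  · by_cases hyu : tr (y * u) = 0
    · exact ⟨x + y, by simpa [add_mul, hyu] using hx, by simpa [add_mul, hxv] using hy⟩
    · exact ⟨y, hyu, hy⟩
  · exact ⟨x, hx, hxv⟩

theorem eq_zero_of_mul_eq_zero {e u : Octonion k} (he : norm e ≠ 0) (h : e * u = 0) : u = 0 := by
  have := conj_mul_mul e u
  rw [h, mul_zero] at this
  exact (smul_eq_zero.1 this.symm).resolve_left he

/-- Two nonzero octonions are nonorthogonal to a common isotropic octonion. -/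
theorem exists_norm_eq_zero_tr_mul_ne_zero₂ {u v : Octonion k} (hu : u ≠ 0) (hv : v ≠ 0) :
    ∃ b, norm b = 0 ∧ tr (b * u) ≠ 0 ∧ tr (b * v) ≠ 0 := by
  -- Every `x * e` is isotropic and tr((xe)u) = tr(x(eu)), so it is enough that `e` annihilates
  -- neither `u` nor `v`.
  have key : ∀ e : Octonion k, norm e = 0 → e * u ≠ 0 → e * v ≠ 0 →
      ∃ b, norm b = 0 ∧ tr (b * u) ≠ 0 ∧ tr (b * v) ≠ 0 := by
    intro e he heu hev
    obtain ⟨x, hxu, hxv⟩ := exists_tr_mul_ne_zero₂ heu hev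
    exact ⟨x * e, by rw [Octonion.norm_mul, he, mul_zero], by rwa [tr_mul_assoc],
      by rwa [tr_mul_assoc]⟩
  have sep : ∀ e e' w : Octonion k, norm (e + -e') ≠ 0 → w ≠ 0 → e * w = 0 → e' * w ≠ 0 := by
    intro e e' w hn hw h h'
    exact hw (eq_zero_of_mul_eq_zero hn (by rw [add_mul, neg_mul, h, h', neg_zero, add_zero]))
  -- When the pairwise differences are invertible, a nonzero octonion is annihilated by at most one
  -- of the three, so some `e` spares both `u` and `v`.
  obtain ⟨e₁, e₂, e₃, n₁, n₂, n₃, n₁₂, n₁₃, n₂₃⟩ : ∃ e₁ e₂ e₃ : Octonion k,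
      norm e₁ = 0 ∧ norm e₂ = 0 ∧ norm e₃ = 0 ∧ norm (e₁ + -e₂) ≠ 0 ∧ norm (e₁ + -e₃) ≠ 0 ∧
        norm (e₂ + -e₃) ≠ 0 := by
    refine ⟨ofCoords 1 0 0 0 0 0 0 0, ofCoords 0 0 0 1 0 0 0 0, ofCoords 1 1 1 1 0 0 0 0, ?_⟩
    simp [norm_ofCoords, neg_ofCoords, add_ofCoords]
  have h12 := fun w => sep e₁ e₂ w n₁₂
  have h13 := fun w => sep e₁ e₃ w n₁₃
  have h23 := fun w => sep e₂ e₃ w n₂₃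
  by_cases c1 : e₁ * u ≠ 0 ∧ e₁ * v ≠ 0
  · exact key e₁ n₁ c1.1 c1.2
  by_cases c2 : e₂ * u ≠ 0 ∧ e₂ * v ≠ 0
  · exact key e₂ n₂ c2.1 c2.2
  rw [not_and_or, not_not, not_not] at c1 c2
  rcases c1 with c1 | c1 <;> rcases c2 with c2 | c2
  · exact absurd c2 (h12 u hu c1)
  · exact key e₃ n₃ (h13 u hu c1) (h23 v hv c2)
  · exact key e₃ n₃ (h23 u hu c2) (h13 v hv c1)
  · exact absurd c2 (h12 v hv c1)

theorem exists_norm_eq_zero_tr_mul_ne_zero {u : Octonion k} (hu : u ≠ 0) :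
    ∃ b, norm b = 0 ∧ tr (b * u) ≠ 0 := by
  obtain ⟨b, h, h', -⟩ := exists_norm_eq_zero_tr_mul_ne_zero₂ hu hu
  exact ⟨b, h, h'⟩

theorem exists_norm_eq (c : k) : ∃ b : Octonion k, norm b = c :=
  ⟨ofCoords c 0 0 1 0 0 0 0, by simp [norm_ofCoords]⟩

theorem exists_tr_mul_eq {u : Octonion k} (hu : u ≠ 0) (c : k) : ∃ x, tr (x * u) = c := by
  obtain ⟨x, hx⟩ := exists_tr_mul_ne_zero hu
  exact ⟨(c / tr (x * u)) • x, by rw [smul_mul_assoc, tr_smul, div_mul_cancel₀ _ hx]⟩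

/-- Every octonion is orthogonal to an invertible octonion of trace zero. -/
theorem exists_tr_eq_zero_norm_ne_zero (r : Octonion k) :
    ∃ b, tr b = 0 ∧ tr (r * b) = 0 ∧ norm b ≠ 0 := by
  obtain ⟨a, b, c, d, e, f, g, h, rfl⟩ := exists_ofCoords r
  -- Taking b = (0, M) makes the trace vanish and leaves one linear condition on an invertible
  -- matrix M.
  have key : ∃ e' f' g' h' : k, h' * e - f' * g + (e' * h - g' * f) = 0 ∧
      e' * h' - f' * g' ≠ 0 := by
    by_cases he : e = 0
    · subst he
      by_cases hh : h = 0
      · exact ⟨1, 0, 0, 1, by simp [hh], by simp⟩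
      by_cases hf : f = 0
      · by_cases hg : g = 0
        · exact ⟨0, 1, 1, 0, by simp [hf, hg], by simp⟩
        · exact ⟨g, h, 0, 1, by rw [hf]; ring, by simpa⟩
      · by_cases hg : g = 0
        · exact ⟨f, 0, h, 1, by rw [hg]; ring, by simpa⟩
        · exact ⟨0, f, -g, 0, by ring, by simpa using ⟨hf, hg⟩⟩
    by_cases hh : h = 0
    · by_cases hf : f = 0
      · by_cases hg : g = 0
        · exact ⟨0, 1, 1, 0, by simp [hf, hg], by simp⟩
        · exact ⟨1, e, 0, g, by rw [hf, hh]; ring, by simpa⟩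
      · by_cases hg : g = 0
        · exact ⟨1, 0, e, f, by rw [hg, hh]; ring, by simpa⟩
        · exact ⟨0, f, -g, 0, by ring, by simpa using ⟨hf, hg⟩⟩
    · exact ⟨e, 0, 0, -h, by ring, by simpa using ⟨he, hh⟩⟩
  obtain ⟨e', f', g', h', h0, h1⟩ := key
  refine ⟨ofCoords 0 0 0 0 e' f' g' h', by simp [tr_ofCoords], ?_, ?_⟩
  · rw [mul_ofCoords, tr_ofCoords]
    linear_combination h0
  · rw [norm_ofCoords]
    intro h2
    apply h1
    linear_combination -h2

end Octonion

end

section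

variable {k : Type*} [Field k]

open Octonion J

/-! ### Transitivity on nonsingular elements -/

namespace J

variable (k) in
/-- The nonsingular element `mk 0 0 1 0 0 1`. -/
def base : J k := mk 0 0 1 0 0 1

theorem det_apply_ne_zero {X : J k} (hX : det X ≠ 0) (g : GE6 k) :
    det ((g : J k ≃ₗ[k] J k) X) ≠ 0 := by
  obtain ⟨g, c, hg⟩ := g
  rw [hg]
  exact mul_ne_zero c.ne_zero hX

/-- A nonzero diagonal entry can be rotated into last place. If the diagonal vanishes, the
determinant is tr(x₁x₂x₃), so x₁ ≠ 0 and a row operation puts a nonzero trace on the diagonal. -/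
theorem exists_apply_eq_of_det_ne_zero {X : J k} (hX : det X ≠ 0) :
    ∃ (h : GE6 k) (s₁ s₂ s₃ : k) (x₁ x₂ x₃ : Octonion k), s₃ ≠ 0 ∧
      (h : J k ≃ₗ[k] J k) X = mk s₁ s₂ s₃ x₁ x₂ x₃ := by
  obtain ⟨r, hr⟩ := exists_rotate (k := k)
  obtain ⟨s₁, s₂, s₃, x₁, x₂, x₃, rfl⟩ := exists_mk X
  by_cases h3 : s₃ = 0
  · by_cases h2 : s₂ = 0
    · by_cases h1 : s₁ = 0
      · have hx : x₁ ≠ 0 := by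
          rintro rfl
          apply hX
          simp [det_mk, h1, h2, h3]
        obtain ⟨a, ha⟩ := exists_tr_mul_ne_zero (u := conj x₁)
          (fun h => hx (by rw [← conj_conj x₁, h, conj_zero]))
        obtain ⟨h, hh⟩ := exists_add_row₂₃ a
        refine ⟨r * r * h, _, _, _, _, _, _, ?_, by
          simp only [Subgroup.coe_mul, LinearEquiv.mul_apply, hh, hr]; rfl⟩
        simpa [h2, h3] using ha
      · exact ⟨r, _, _, _, _, _, _, h1, hr _ _ _ _ _ _⟩
    · exact ⟨r * r, _, _, _, _, _, _, h2, by
        simp only [Subgroup.coe_mul, LinearEquiv.mul_apply, hr]; rfl⟩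
  · exact ⟨1, _, _, _, _, _, _, h3, rfl⟩

/-- Completing the square with the pivot `s₃` splits off the upper 2 × 2 block. -/
theorem exists_apply_eq_block (s₁ s₂ : k) {s₃ : k} (h₃ : s₃ ≠ 0) (x₁ x₂ x₃ : Octonion k) :
    ∃ (h : GE6 k) (t₁ t₂ : k) (y : Octonion k),
      (h : J k ≃ₗ[k] J k) (mk s₁ s₂ s₃ x₁ x₂ x₃) = mk t₁ t₂ s₃ 0 0 y := by
  obtain ⟨g, hg⟩ := exists_add_row₁₃ (-(s₃⁻¹ • conj x₂))
  obtain ⟨h, hh⟩ := exists_add_row₂₃ (-(s₃⁻¹ • x₁))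
  have e := (congrArg (h : J k ≃ₗ[k] J k) (hg s₁ s₂ s₃ x₁ x₂ x₃)).trans (hh _ _ _ _ _ _)
  simp only [conj_neg, conj_smul, conj_conj, smul_neg, smul_inv_smul₀ h₃, add_neg_cancel] at e
  exact ⟨h * g, _, _, _, e⟩

theorem exists_apply_eq_of_block {s₁ s₂ s₃ : k} {x : Octonion k} (hd : x.norm - s₁ * s₂ ≠ 0) :
    ∃ (h : GE6 k) (t : k) (y : Octonion k), y.norm ≠ 0 ∧
      (h : J k ≃ₗ[k] J k) (mk s₁ s₂ s₃ 0 0 x) = mk 0 t s₃ 0 0 y := by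
  by_cases h2 : s₂ = 0
  · subst h2
    rw [mul_zero, sub_zero] at hd
    have hx : conj x ≠ 0 := fun h => hd (by rw [← Octonion.norm_conj, h, Octonion.norm_zero])
    obtain ⟨a, ha⟩ := exists_tr_mul_eq hx (-s₁)
    obtain ⟨h, hh⟩ := exists_add_row₁₂ a
    exact ⟨h, 0, x, hd, by rw [hh]; simp [ha]⟩
  -- The operation below replaces `x` by `w` and preserves |x| - s₁s₂, so this choice of norm forces
  -- the first diagonal entry to vanish.
  · obtain ⟨w, hw⟩ := exists_norm_eq (x.norm - s₁ * s₂)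
    obtain ⟨h, hh⟩ := exists_add_row₁₂ (s₂⁻¹ • (w + -x))
    refine ⟨h, s₂, w, hw ▸ hd, ?_⟩
    rw [hh, mk_inj]
    refine ⟨⟨?_, rfl, rfl⟩, rfl, ?_, ?_⟩
    · simp only [smul_mul_assoc, add_mul, neg_mul, mul_conj, Octonion.norm_smul, norm_add, tr_smul,
        tr_add, tr_neg, conj_neg, mul_neg, tr_one, hw, Octonion.norm_neg]
      field_simp
      ring
    · simp
    · rw [smul_inv_smul₀ h2]
      abel

theorem exists_apply_eq_smul_base {X : J k} (hX : det X ≠ 0) :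
    ∃ (h : GE6 k) (c : k), c ≠ 0 ∧ (h : J k ≃ₗ[k] J k) X = c • base k := by
  obtain ⟨g₁, s₁, s₂, s₃, x₁, x₂, x₃, h₃, e₁⟩ := exists_apply_eq_of_det_ne_zero hX
  obtain ⟨g₂, t₁, t₂, x, e₂⟩ := exists_apply_eq_block s₁ s₂ h₃ x₁ x₂ x₃
  have hd : x.norm - t₁ * t₂ ≠ 0 := by
    intro h
    apply det_apply_ne_zero (det_apply_ne_zero hX g₁) g₂
    rw [e₁, e₂]
    simp only [det_mk, mul_zero, zero_mul, tr_zero, Octonion.norm_zero]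
    linear_combination -s₃ * h
  obtain ⟨g₃, t, y, hy, e₃⟩ := exists_apply_eq_of_block (s₃ := s₃) hd
  have hy0 : y ≠ 0 := fun h => hy (by rw [h, Octonion.norm_zero])
  obtain ⟨c, hc⟩ := exists_tr_mul_eq hy0 (-t)
  obtain ⟨g₄, hg₄⟩ := exists_add_row₂₁ c
  obtain ⟨r, hr⟩ := exists_rotate (k := k)
  obtain ⟨m, hm⟩ := exists_triality (conj y) (by rwa [Octonion.norm_conj])
  obtain ⟨d, hd⟩ := exists_torus s₃ 1 1 h₃ one_ne_zero one_ne_zero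
  -- `g₄` clears the second diagonal entry by means of the invertible `y`, triality by `conj y`
  -- turns `y` into its norm, and the torus makes this scalar agree with the last diagonal entry.
  refine ⟨d * r * m * r * r * g₄ * g₃ * g₂ * g₁, y.norm * s₃, mul_ne_zero hy h₃, ?_⟩
  simp only [Subgroup.coe_mul, LinearEquiv.mul_apply, hr, hm, hd, e₁, e₂, e₃, hg₄, base, smul_mk,
    mk_inj, Octonion.norm_conj, hc]
  simp [mul_comm, smul_smul]

end J

theorem exists_sameOrbit_base (X Y : J k) (hX : J.det X ≠ 0) :
    ∃ (s₁ s₂ : k) (x₁ x₂ x₃ : Octonion k),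
      SameOrbit ![X, Y] ![base k, mk s₁ s₂ 0 x₁ x₂ x₃] := by
  obtain ⟨h, c, hc, e⟩ := exists_apply_eq_smul_base hX
  have h₁ := SameOrbit.of_GE6 h X Y
  rw [e] at h₁
  have h₂ := h₁.trans (SameOrbit.smul_left (inv_ne_zero hc) _ _)
  rw [inv_smul_smul₀ hc] at h₂
  obtain ⟨s₁, s₂, s₃, x₁, x₂, x₃, e'⟩ := exists_mk ((h : J k ≃ₗ[k] J k) Y)
  rw [e'] at h₂
  -- Subtracting `s₃` times `base` clears the last diagonal entry of the second component.
  refine ⟨s₁, s₂, x₁, x₂, x₃ + (-s₃) • 1, h₂.trans ?_⟩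
  convert SameOrbit.add_smul (-s₃) (base k) (mk s₁ s₂ s₃ x₁ x₂ x₃) using 3
  rw [base, smul_mk, mk_add]
  simp

/-! ### The stabilizer of the base point -/

/-- A unipotent element of the stabilizer of `base`, followed by a translation by a multiple of
`base`. -/
theorem sameOrbit_unipotent (s₁ s₂ : k) (x₁ x₂ x₃ γ : Octonion k) {t : k}
    (ht : γ.norm + 2 * t = 0) :
    SameOrbit ![base k, mk s₁ s₂ 0 x₁ x₂ x₃] ![base k,
      mk (s₁ + tr (conj γ * x₂) + t * tr (x₃ + conj γ * conj x₁) + t ^ 2 * s₂) s₂ 0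
        (x₁ + -(s₂ • conj γ)) (x₂ + -(γ * (conj x₃ + x₁ * γ)) + t • (conj x₁ + -(s₂ • γ)))
        (x₃ + conj γ * conj x₁ + (s₂ * t + tr (γ * x₁) - γ.norm * s₂) • 1)] := by
  -- `g₁` and `g₂` together restore `base` up to an entry |γ| in the first diagonal place, which
  -- `g₃` cancels because |γ| + 2t = 0.
  obtain ⟨g₁, hg₁⟩ := exists_add_row₁₃ (conj γ)
  obtain ⟨g₂, hg₂⟩ := exists_add_row₃₂ (-γ)
  obtain ⟨g₃, hg₃⟩ := exists_add_row₁₂ (t • (1 : Octonion k))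
  have h := SameOrbit.of_GE6 (g₃ * g₂ * g₁) (base k) (mk s₁ s₂ 0 x₁ x₂ x₃)
  have e : ((g₃ * g₂ * g₁ : GE6 k) : J k ≃ₗ[k] J k) (base k) = base k := by
    simp only [Subgroup.coe_mul, LinearEquiv.mul_apply, base, hg₁, hg₂, hg₃, mk_inj]
    simp
    linear_combination ht
  rw [e] at h
  refine h.trans ?_
  -- This multiple of `base` returns the last diagonal entry, changed by `g₂`, to zero.
  convert SameOrbit.add_smul (tr (γ * x₁) - γ.norm * s₂) (base k)
    (((g₃ * g₂ * g₁ : GE6 k) : J k ≃ₗ[k] J k) (mk s₁ s₂ 0 x₁ x₂ x₃)) using 3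
  simp only [Subgroup.coe_mul, LinearEquiv.mul_apply, base, hg₁, hg₂, hg₃, mk_inj, smul_mk, mk_add]
  refine ⟨⟨?_, ?_, ?_⟩, ?_, ?_, ?_⟩
  · simp
    rw [← tr_conj (x₁ * γ), Octonion.conj_mul]
    ring
  · simp
  · simp
  · simp
  · simp [mul_add]
    abel
  · simp [smul_smul, _root_.add_smul, sub_smul, add_assoc]
    abel

end

/-! ### Reduction to a common isotropic row -/

section

variable {k : Type*} [Field k]

open Octonion J

/-- The cubic form is u(s₁s₂v² - (u + ρv)²), of discriminant 4s₁s₂(ρ² - s₁s₂)². -/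
theorem discr_base_ne_zero (h2 : (2 : k) ≠ 0) {s₁ s₂ ρ : k}
    (h : ![base k, mk s₁ s₂ 0 0 0 (ρ • 1)] ∈ Vss k) :
    s₁ ≠ 0 ∧ s₂ ≠ 0 ∧ ρ ^ 2 - s₁ * s₂ ≠ 0 := by
  have e := binaryCubic_eq h2 (x := ![base k, mk s₁ s₂ 0 0 0 (ρ • 1)]) (p := -(2 * ρ))
    (q := s₁ * s₂ - ρ ^ 2) (fun u v => by
      have h1 : u • (1 : Octonion k) + v • ρ • (1 : Octonion k) = (u + v * ρ) • 1 := by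
        rw [smul_smul, add_smul]
      simp only [Matrix.cons_val_zero, Matrix.cons_val_one, base, smul_mk, mk_add, det_mk,
        smul_zero, mul_zero, zero_mul, add_zero, zero_add, h1, tr_zero, Octonion.norm_zero,
        Octonion.norm_smul, Octonion.norm_one]
      ring)
  have h' : (binaryCubic J.det ![base k, mk s₁ s₂ 0 0 0 (ρ • 1)]).discr ≠ 0 := h
  rw [e] at h'
  have : 4 * s₁ * s₂ * (ρ ^ 2 - s₁ * s₂) ^ 2 ≠ 0 := by
    convert h' using 1
    simp only [Cubic.discr, Matrix.cons_val_zero, Matrix.cons_val_one, base, det_mk, mul_zero,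
      zero_mul, tr_zero, Octonion.norm_zero, Octonion.norm_smul, Octonion.norm_one]
    ring
  refine ⟨?_, ?_, ?_⟩ <;> intro h0 <;> apply this <;> simp [h0]

theorem sameOrbit_unipotent_of_norm_eq_zero (s₁ s₂ : k) (x₁ x₂ x₃ : Octonion k) {γ : Octonion k}
    (hγ : γ.norm = 0) :
    SameOrbit ![base k, mk s₁ s₂ 0 x₁ x₂ x₃] ![base k,
      mk (s₁ + tr (conj γ * x₂)) s₂ 0 (x₁ + -(s₂ • conj γ)) (x₂ + -(γ * (conj x₃ + x₁ * γ)))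
        (x₃ + conj γ * conj x₁ + tr (γ * x₁) • 1)] := by
  have h := sameOrbit_unipotent s₁ s₂ x₁ x₂ x₃ γ (t := 0) (by rw [hγ]; ring)
  simpa [hγ] using h

theorem mul_mul_self_of_norm_eq_zero {γ : Octonion k} (hγ : γ.norm = 0) (x : Octonion k) :
    γ * (x * γ) = tr (γ * x) • γ := by
  have h := congrArg conj (mul_mul_self (conj γ) (conj x))
  simp only [Octonion.conj_mul, conj_conj, conj_smul, Octonion.norm_conj, hγ,
    zero_smul, neg_zero, add_zero] at h
  rw [h, ← tr_conj, Octonion.conj_mul, conj_conj, conj_conj, tr_mul_comm]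

theorem eq_zero_of_forall_tr_mul {y : Octonion k} (h : ∀ γ : Octonion k, γ.norm = 0 →
    tr (γ * y) = 0) : y = 0 := by
  by_contra hy
  obtain ⟨b, hb, hby⟩ := exists_norm_eq_zero_tr_mul_ne_zero hy
  exact hby (h b hb)

/-- If every isotropic γ left x₂ = 0, then γ(conj x₃ + x₁γ) = 0 for all of them. Comparing γ with -γ
separates the parts of degree one and two and gives x₁ = x₃ = 0; the discriminant is then zero
because s₁ = 0. -/
theorem exists_sameOrbit_x₂_ne_zero (h2 : (2 : k) ≠ 0) {s₂ : k} {x₁ x₃ : Octonion k}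
    (h : ![base k, mk 0 s₂ 0 x₁ 0 x₃] ∈ Vss k) :
    ∃ (t₁ t₂ : k) (y₁ y₂ y₃ : Octonion k), y₂ ≠ 0 ∧
      SameOrbit ![base k, mk 0 s₂ 0 x₁ 0 x₃] ![base k, mk t₁ t₂ 0 y₁ y₂ y₃] := by
  by_contra! H
  have H1 : ∀ γ : Octonion k, γ.norm = 0 → γ * (conj x₃ + x₁ * γ) = 0 := by
    intro γ hγ
    by_contra hne
    refine H _ _ _ _ _ ?_ (sameOrbit_unipotent_of_norm_eq_zero 0 s₂ x₁ 0 x₃ hγ)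
    rwa [zero_add, neg_ne_zero]
  have H2 : ∀ γ : Octonion k, γ.norm = 0 → γ * conj x₃ = 0 ∧ γ * (x₁ * γ) = 0 := by
    intro γ hγ
    have e1 := H1 γ hγ
    have e2 := H1 (-γ) (by rwa [Octonion.norm_neg])
    rw [mul_add] at e1
    simp only [mul_add, neg_mul, mul_neg, neg_neg] at e2
    have e3 : (2 : k) • (γ * (x₁ * γ)) = 0 := by
      have e4 : γ * (x₁ * γ) + γ * (x₁ * γ) =
        γ * conj x₃ + γ * (x₁ * γ) + (-(γ * conj x₃) + γ * (x₁ * γ)) := by abel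
      rw [two_smul, e4, e1, e2, add_zero]
    have e4 := (smul_eq_zero.1 e3).resolve_left h2
    rw [e4, add_zero] at e1
    exact ⟨e1, e4⟩
  have hx₃ : x₃ = 0 := by
    have : conj x₃ = 0 := eq_zero_of_forall_tr_mul fun γ hγ => by rw [(H2 γ hγ).1, tr_zero]
    rw [← conj_conj x₃, this, conj_zero]
  have hx₁ : x₁ = 0 := eq_zero_of_forall_tr_mul fun γ hγ => by
    have h1 := (H2 γ hγ).2
    rw [mul_mul_self_of_norm_eq_zero hγ] at h1
    rcases smul_eq_zero.1 h1 with h1 | h1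
    · exact h1
    · rw [h1, zero_mul, tr_zero]
  subst hx₁ hx₃
  have h' : ![base k, mk 0 s₂ 0 0 0 ((0 : k) • 1)] ∈ Vss k := by rwa [zero_smul]
  exact (discr_base_ne_zero h2 h').1 rfl

/-- An isotropic unipotent adds tr(conj γ · x₂) to s₁, so once x₂ ≠ 0 a suitable γ exists. -/
theorem exists_sameOrbit_s₁_ne_zero (h2 : (2 : k) ≠ 0) {s₁ s₂ : k} {x₁ x₂ x₃ : Octonion k}
    (h : ![base k, mk s₁ s₂ 0 x₁ x₂ x₃] ∈ Vss k) :
    ∃ (t₁ t₂ : k) (y₁ y₂ y₃ : Octonion k), t₁ ≠ 0 ∧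
      SameOrbit ![base k, mk s₁ s₂ 0 x₁ x₂ x₃] ![base k, mk t₁ t₂ 0 y₁ y₂ y₃] := by
  by_cases hs : s₁ = 0
  swap
  · exact ⟨_, _, _, _, _, hs, SameOrbit.refl _⟩
  subst hs
  have key : ∀ (s₂ : k) (x₁ x₂ x₃ : Octonion k), x₂ ≠ 0 →
      ∃ (t₁ t₂ : k) (y₁ y₂ y₃ : Octonion k), t₁ ≠ 0 ∧
        SameOrbit ![base k, mk 0 s₂ 0 x₁ x₂ x₃] ![base k, mk t₁ t₂ 0 y₁ y₂ y₃] := by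
    intro s₂ x₁ x₂ x₃ hx
    obtain ⟨b, hb, hbx⟩ := exists_norm_eq_zero_tr_mul_ne_zero hx
    refine ⟨_, _, _, _, _, ?_, sameOrbit_unipotent_of_norm_eq_zero 0 s₂ x₁ x₂ x₃ (γ := conj b)
      (by rwa [Octonion.norm_conj])⟩
    rwa [zero_add, conj_conj]
  by_cases hx : x₂ = 0
  · subst hx
    obtain ⟨t₁, t₂, y₁, y₂, y₃, hy, hr⟩ := exists_sameOrbit_x₂_ne_zero h2 h
    by_cases ht : t₁ = 0
    · subst ht
      obtain ⟨u₁, u₂, z₁, z₂, z₃, hu, hr'⟩ := key t₂ y₁ y₂ y₃ hy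
      exact ⟨u₁, u₂, z₁, z₂, z₃, hu, hr.trans hr'⟩
    · exact ⟨t₁, t₂, y₁, y₂, y₃, ht, hr⟩
  · exact key s₂ x₁ x₂ x₃ hx

theorem sameOrbit_swap (s₁ s₂ : k) (x₁ x₂ x₃ : Octonion k) :
    SameOrbit ![base k, mk s₁ s₂ 0 x₁ x₂ x₃]
      ![base k, mk s₂ s₁ 0 (conj x₂) (conj x₁) (conj x₃)] := by
  obtain ⟨r, hr⟩ := exists_swap (k := k)
  simpa [base, hr] using SameOrbit.of_GE6 r (base k) (mk s₁ s₂ 0 x₁ x₂ x₃)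

/-- The entry `s₁` serves as pivot. The unipotent conjugated by the swap clears x₂; a row operation
with a trace-zero parameter, which fixes `base`, then removes the trace-zero part of x₃. -/
theorem exists_sameOrbit_x₂_eq_zero (h2 : (2 : k) ≠ 0) {s₁ : k} (hs : s₁ ≠ 0) (s₂ : k)
    (x₁ x₂ x₃ : Octonion k) : ∃ (t ρ : k) (y : Octonion k),
      SameOrbit ![base k, mk s₁ s₂ 0 x₁ x₂ x₃] ![base k, mk s₁ t 0 y 0 (ρ • 1)] := by
  obtain ⟨t, y, z, e1⟩ : ∃ (t : k) (y z : Octonion k),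
      SameOrbit ![base k, mk s₁ s₂ 0 x₁ x₂ x₃] ![base k, mk s₁ t 0 y 0 z] := by
    have e1 := (sameOrbit_swap s₁ s₂ x₁ x₂ x₃).trans
      ((sameOrbit_unipotent s₂ s₁ (conj x₂) (conj x₁) (conj x₃) (s₁⁻¹ • x₂)
        (t := -((s₁⁻¹ • x₂).norm / 2)) (by field_simp; ring)).trans (sameOrbit_swap _ _ _ _ _))
    have e2 : conj (conj x₂ + -(s₁ • conj (s₁⁻¹ • x₂))) = 0 := by
      rw [conj_smul, smul_inv_smul₀ hs, add_neg_cancel, conj_zero]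
    rw [e2] at e1
    exact ⟨_, _, _, e1⟩
  obtain ⟨g, hg⟩ := exists_add_row₂₁ (conj (s₁⁻¹ • ((tr z / 2) • (1 : Octonion k) + -z)))
  have hb : (g : J k ≃ₗ[k] J k) (base k) = base k := by
    rw [base, hg, mk_inj]
    simp
    field_simp
    ring
  have e3 := SameOrbit.of_GE6 g (base k) (mk s₁ t 0 y 0 z)
  rw [hb, hg, conj_conj, smul_inv_smul₀ hs, conj_zero, mul_zero, add_zero, add_comm z,
    neg_add_cancel_right] at e3
  exact ⟨_, _, _, e1.trans e3⟩

/-- The point is in the orbit of a pair whose first rows are `(0, 1, 0)` and `(0, *, y)` with `y`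
invertible. -/
def HasIsotropicRow (x : V k) : Prop :=
  ∃ (s₂ s₃ : k) (x₁ x₂ x₃ : Octonion k), x₂.norm ≠ 0 ∧
    SameOrbit x ![base k, mk 0 s₂ s₃ x₁ x₂ x₃]

theorem HasIsotropicRow.of_sameOrbit {x y : V k} (h : SameOrbit x y) (hy : HasIsotropicRow y) :
    HasIsotropicRow x := by
  obtain ⟨s₂, s₃, x₁, x₂, x₃, hn, ho⟩ := hy
  exact ⟨s₂, s₃, x₁, x₂, x₃, hn, h.trans ho⟩

/-- For isotropic b with tr(b x₂) = -s₁, the operations `g₁` and `g₂` fix `base` and send s₁ to 0.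
If w is the vector in `h`, the norm N of the new x₂ satisfies -s₁N = tr(b w). Hence b only has to
pair nontrivially with both x₂ and w, up to rescaling. -/
theorem hasIsotropicRow_of_ne_zero {s₁ s₂ : k} {x₁ x₂ x₃ : Octonion k} (hs : s₁ ≠ 0) (hx : x₂ ≠ 0)
    (h : s₁ • (x₂ * x₃ + -(s₁ • conj x₁)) + x₂.norm • x₂ ≠ 0) :
    HasIsotropicRow ![base k, mk s₁ s₂ 0 x₁ x₂ x₃] := by
  obtain ⟨b₀, hb₀, h₁, h₂⟩ := exists_norm_eq_zero_tr_mul_ne_zero₂ hx h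
  set b := (-s₁ / tr (b₀ * x₂)) • b₀ with hb
  have hn : b.norm = 0 := by rw [hb, Octonion.norm_smul, hb₀, mul_zero]
  have hbx : tr (b * x₂) = -s₁ := by rw [hb, smul_mul_assoc, tr_smul, div_mul_cancel₀ _ h₁]
  have hbv : tr (b * (s₁ • (x₂ * x₃ + -(s₁ • conj x₁)) + x₂.norm • x₂)) ≠ 0 := by
    rw [hb, smul_mul_assoc, tr_smul]
    exact mul_ne_zero (div_ne_zero (neg_ne_zero.2 hs) h₁) h₂
  clear_value b
  obtain ⟨g₁, hg₁⟩ := exists_add_row₁₃ b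
  obtain ⟨g₂, hg₂⟩ := exists_add_row₃₂ (-conj b)
  have e := SameOrbit.of_GE6 (g₂ * g₁) (base k) (mk s₁ s₂ 0 x₁ x₂ x₃)
  have hbase : ((g₂ * g₁ : GE6 k) : J k ≃ₗ[k] J k) (base k) = base k := by
    simp only [Subgroup.coe_mul, LinearEquiv.mul_apply, base, hg₁, hg₂, mk_inj]
    simp [hn]
  rw [hbase, Subgroup.coe_mul, LinearEquiv.mul_apply, hg₁, hg₂, hbx, mul_zero, add_zero,
    add_neg_cancel] at e
  refine ⟨_, _, _, _, _, ?_, e⟩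
  have e1 : b * conj x₁ * b = tr (b * conj x₁) • b := by
    rw [mul_mul_self, hn, zero_smul, neg_zero, add_zero]
  have e2 : tr (x₂ * (x₃ * b)) = tr (b * (x₂ * x₃)) := by
    rw [← tr_mul_assoc, tr_mul_comm]
  rw [zero_smul, add_zero, norm_add, Octonion.norm_mul, Octonion.norm_neg, Octonion.norm_conj, hn,
    zero_mul, add_zero, Octonion.conj_mul, conj_conj, conj_neg, conj_conj, mul_neg, mul_neg, tr_neg,
    add_mul, mul_add, tr_add, e1, mul_smul_comm, tr_smul, e2]
  rw [tr_mul_comm x₂ b, hbx]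
  intro h0
  apply hbv
  simp only [mul_add, mul_neg, mul_smul_comm, tr_add, tr_neg, tr_smul, hbx]
  linear_combination -s₁ * h0

/-- A suitable isotropic γ makes x₂ a nonzero multiple of γ, so the norm term in
`hasIsotropicRow_of_ne_zero` drops out. If the rest vanished, s₁ conj x would be a multiple of γ, so
x would have norm zero; multiplying by x and taking traces shows that the factor is zero, whence x =
0. -/
theorem hasIsotropicRow_of_x₁_ne_zero (h2 : (2 : k) ≠ 0) {s₁ : k} (s₂ ρ : k) {x : Octonion k}
    (hs : s₁ ≠ 0) (hx : x ≠ 0) : HasIsotropicRow ![base k, mk s₁ s₂ 0 x 0 (ρ • 1)] := by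
  obtain ⟨γ, hγ, hτ, hρ⟩ : ∃ γ : Octonion k, γ.norm = 0 ∧ tr (γ * x) ≠ 0 ∧
      ρ + tr (γ * x) ≠ 0 := by
    obtain ⟨γ, hγ, hτ⟩ := exists_norm_eq_zero_tr_mul_ne_zero hx
    -- If both γ and -γ failed, 2 tr(γx) would vanish.
    by_cases hρ : ρ + tr (γ * x) = 0
    · refine ⟨-γ, by rwa [Octonion.norm_neg], by rwa [neg_mul, tr_neg, neg_ne_zero], fun h => ?_⟩
      rw [neg_mul, tr_neg] at h
      exact mul_ne_zero h2 hτ (by linear_combination hρ - h)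
    · exact ⟨γ, hγ, hτ, hρ⟩
  refine HasIsotropicRow.of_sameOrbit
    (sameOrbit_unipotent_of_norm_eq_zero s₁ s₂ x 0 (ρ • 1) hγ) ?_
  have e1 : γ * (conj (ρ • 1) + x * γ) = (ρ + tr (γ * x)) • γ := by
    rw [mul_add, mul_mul_self_of_norm_eq_zero hγ, conj_smul, conj_one, mul_smul_comm, mul_one,
      add_smul]
  have hγ0 : γ ≠ 0 := by
    rintro rfl
    simp at hτ
  rw [e1, zero_add, mul_zero, tr_zero, add_zero]
  refine hasIsotropicRow_of_ne_zero hs (neg_ne_zero.2 (smul_ne_zero hρ hγ0)) fun h => ?_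
  have e2 : γ * (conj γ * conj x) = 0 := by rw [mul_conj_mul, hγ, zero_smul]
  rw [Octonion.norm_neg, Octonion.norm_smul, hγ, mul_zero, zero_smul, add_zero, smul_eq_zero,
    or_iff_right hs] at h
  simp only [mul_add, neg_mul, smul_mul_assoc, mul_smul_comm, e2, mul_one, smul_zero, conj_add,
    conj_neg, conj_smul, conj_conj] at h
  have e3 : s₁ • conj x = (s₁ * s₂ - (ρ + tr (γ * x)) ^ 2) • γ := by
    rw [← sub_eq_zero, ← neg_eq_zero, ← h]
    module
  have e4 := congrArg Octonion.norm e3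
  rw [Octonion.norm_smul, Octonion.norm_smul, hγ, mul_zero, Octonion.norm_conj, mul_eq_zero,
    or_iff_right (pow_ne_zero 2 hs)] at e4
  have e5 := congrArg (fun y => tr (y * x)) e3
  simp only [smul_mul_assoc, conj_mul_self, e4, zero_smul, smul_zero, tr_zero, tr_smul] at e5
  rw [(mul_eq_zero.1 e5.symm).resolve_right hτ, zero_smul] at e3
  apply hx
  rw [← conj_conj x, (smul_eq_zero.1 e3).resolve_left hs, conj_zero]

/-- For ρ = 0 an isotropic γ would leave x₂ = 0, so γ of norm -2t is used with t generic. -/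
theorem hasIsotropicRow_of_x₁_eq_zero [Infinite k] (h2 : (2 : k) ≠ 0) {s₁ s₂ ρ : k}
    (h : ![base k, mk s₁ s₂ 0 0 0 (ρ • 1)] ∈ Vss k) :
    HasIsotropicRow ![base k, mk s₁ s₂ 0 0 0 (ρ • 1)] := by
  obtain ⟨h₁, h₂, hΔ⟩ := discr_base_ne_zero h2 h
  -- The factors are, up to sign, the coefficient of γ in the new x₂, the new s₁, and the part
  -- depending on t of the coefficient in `e4`. Each is a nonzero polynomial since s₁ and s₂ are
  -- nonzero.
  obtain ⟨t, ht⟩ : ∃ t : k, (ρ + s₂ * t) * (s₁ + 2 * ρ * t + s₂ * t ^ 2) * (s₁ - s₂ * t ^ 2) ≠ 0 := by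
    by_contra! H
    have H' : (Polynomial.C ρ + Polynomial.C s₂ * Polynomial.X) *
        (Polynomial.C s₁ + Polynomial.C (2 * ρ) * Polynomial.X +
          Polynomial.C s₂ * Polynomial.X ^ 2) *
        (Polynomial.C s₁ - Polynomial.C s₂ * Polynomial.X ^ 2) = 0 :=
      Polynomial.funext fun t => by simpa using H t
    rcases mul_eq_zero.1 H' with H' | H'
    · rcases mul_eq_zero.1 H' with H' | H'
      · have := congrArg (Polynomial.coeff · 1) H'
        simp at this
        exact h₂ this
      · have := congrArg (Polynomial.eval 0) H'
        simp at this
        exact h₁ this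
    · have := congrArg (Polynomial.eval 0) H'
      simp at this
      exact h₁ this
  obtain ⟨⟨hq, hr⟩, hs⟩ := (mul_ne_zero_iff.1 ht).imp_left mul_ne_zero_iff.1
  obtain ⟨γ, hγ0, hγ⟩ : ∃ γ : Octonion k, γ ≠ 0 ∧ γ.norm + 2 * t = 0 := by
    refine ⟨ofCoords (-(2 * t)) 0 0 1 0 0 0 0, fun h => ?_, by rw [norm_ofCoords]; ring⟩
    rw [zero_eq_ofCoords, ofCoords_inj] at h
    exact one_ne_zero h.2.2.2.1
  refine HasIsotropicRow.of_sameOrbit (sameOrbit_unipotent s₁ s₂ 0 0 (ρ • 1) γ hγ) ?_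
  have hn : γ.norm = -(2 * t) := by linear_combination hγ
  have e1 : s₁ + tr (conj γ * 0) + t * tr (ρ • 1 + conj γ * conj 0) + t ^ 2 * s₂ =
      s₁ + 2 * ρ * t + s₂ * t ^ 2 := by
    simp only [mul_zero, tr_zero, conj_zero, add_zero, tr_smul, tr_one]
    ring
  have e2 : 0 + -(γ * (conj (ρ • 1) + 0 * γ)) + t • (conj 0 + -(s₂ • γ)) =
      (-(ρ + s₂ * t)) • γ := by
    simp only [conj_smul, conj_one, zero_mul, add_zero, zero_add, conj_zero, mul_smul_comm, mul_one]
    module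
  have e3 : ρ • 1 + conj γ * conj 0 + (s₂ * t + tr (γ * 0) - γ.norm * s₂) • (1 : Octonion k) =
      (ρ + 3 * s₂ * t) • 1 := by
    simp only [conj_zero, mul_zero, tr_zero, hn]
    module
  rw [e1, e2, e3]
  refine hasIsotropicRow_of_ne_zero hr (smul_ne_zero (neg_ne_zero.2 hq) hγ0) ?_
  have e4 : (s₁ + 2 * ρ * t + s₂ * t ^ 2) • ((-(ρ + s₂ * t)) • γ * (ρ + 3 * s₂ * t) • 1 +
      -((s₁ + 2 * ρ * t + s₂ * t ^ 2) • conj (0 + -(s₂ • conj γ)))) +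
      ((-(ρ + s₂ * t)) • γ).norm • (-(ρ + s₂ * t)) • γ =
      (-((ρ ^ 2 - s₁ * s₂) * (s₁ - s₂ * t ^ 2))) • γ := by
    simp only [Octonion.norm_smul, hn, conj_neg, conj_smul, conj_conj, mul_smul_comm, mul_one,
      zero_add]
    module
  rw [e4]
  exact smul_ne_zero (neg_ne_zero.2 (mul_ne_zero hΔ hs)) hγ0

theorem hasIsotropicRow_of_mem_Vss [Infinite k] (h2 : (2 : k) ≠ 0) {x : V k} (hx : x ∈ Vss k) :
    HasIsotropicRow x := by
  obtain ⟨X, Y, h₁, hX⟩ := exists_sameOrbit_det_ne_zero hx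
  obtain ⟨s₁, s₂, x₁, x₂, x₃, h₂⟩ := exists_sameOrbit_base X Y hX
  obtain ⟨t₁, t₂, y₁, y₂, y₃, ht, h₃⟩ :=
    exists_sameOrbit_s₁_ne_zero h2 ((h₁.trans h₂).mem_Vss h2 hx)
  obtain ⟨u, ρ, z, h₄⟩ := exists_sameOrbit_x₂_eq_zero h2 ht t₂ y₁ y₂ y₃
  have h := ((h₁.trans h₂).trans h₃).trans h₄
  refine HasIsotropicRow.of_sameOrbit h ?_
  by_cases hz : z = 0
  · subst hz
    exact hasIsotropicRow_of_x₁_eq_zero h2 (h.mem_Vss h2 hx)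
  · exact hasIsotropicRow_of_x₁_ne_zero h2 u ρ ht hz

end

/-! ### Reduction to pairs of ternary quadratic forms -/

section

variable {k : Type*} [Field k]

open Octonion J

namespace J

/-- A similitude of the determinant attached to an invertible octonion of trace zero. -/
theorem exists_triality_of_tr_eq_zero {b : Octonion k} (hb : b.norm ≠ 0) (htr : tr b = 0) :
    ∃ h : GE6 k, ∀ s₁ s₂ s₃ x₁ x₂ x₃, (h : J k ≃ₗ[k] J k) (mk s₁ s₂ s₃ x₁ x₂ x₃) =
      mk (b.norm * s₁) (b.norm * s₂) (b.norm * (b.norm * s₃)) (conj b * (x₁ * b) * conj b)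
        (-(b.norm • (x₂ * b))) (b * x₃ * b) := by
  obtain ⟨r, hr⟩ := exists_rotate (k := k)
  obtain ⟨m, hm⟩ := exists_triality b hb
  have hc : conj b = -b := by rw [conj_eq, htr, zero_smul, zero_add]
  -- Two cyclic conjugates of `m` compose to put `b` on both sides of x₃. A scalar there stays
  -- scalar, because b² = -|b| when the trace is zero.
  refine ⟨r * r * m * r * (r * m * r * r), fun s₁ s₂ s₃ x₁ x₂ x₃ => ?_⟩
  have h : b * (conj b * x₂ * conj b) = -(b.norm • (x₂ * b)) := by
    have h' : conj b * x₂ * conj b = conj b * (x₂ * conj b) := by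
      have e := congrArg conj (mul_mul_self b (conj x₂))
      simp only [Octonion.conj_mul, conj_conj, conj_add, conj_neg, conj_smul] at e
      rw [e, mul_mul_self, Octonion.norm_conj, ← tr_conj (conj b * x₂), Octonion.conj_mul,
        conj_conj, tr_mul_comm]
    rw [h', mul_conj_mul, hc, mul_neg, smul_neg]
  simp only [Subgroup.coe_mul, LinearEquiv.mul_apply, hr, hm, h]

end J

/-- A pair of symmetric matrices over `k`, as an element of `V`; both quadratic forms vanish at
`(1, 0, 0)`. -/
theorem HasIsotropicRow.exists_sameOrbit {x : V k} (hx : HasIsotropicRow x) :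
    ∃ s t s' t' : k, t ≠ 0 ∧ SameOrbit x ![mk 0 s t 0 0 1, mk 0 s' t' 0 1 0] := by
  obtain ⟨s₂, s₃, x₁, x₂, x₃, hn, ho⟩ := hx
  -- Since conj x₂ · (x₂x₃) = |x₂|x₃, this clears x₃ in the second component.
  obtain ⟨g₁, hg₁⟩ := exists_add_row₂₃ (conj (-(x₂.norm⁻¹ • (x₂ * x₃))))
  -- Triality by `b` and then by `conj (x₂ * b)` turns x₂ into a scalar. Both parameters have trace
  -- zero, so the entry 1 of `base` also remains scalar.
  obtain ⟨b, hb, hxb, hbn⟩ := exists_tr_eq_zero_norm_ne_zero x₂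
  have hbn' : (conj (x₂ * b)).norm ≠ 0 := by
    rw [Octonion.norm_conj, Octonion.norm_mul]
    exact mul_ne_zero hn hbn
  obtain ⟨g₂, hg₂⟩ := exists_triality_of_tr_eq_zero hbn hb
  obtain ⟨g₃, hg₃⟩ := exists_triality_of_tr_eq_zero hbn' (by rwa [tr_conj])
  have sq : ∀ c : Octonion k, tr c = 0 → c * c = -(c.norm • 1) := fun c hc => by
    have h := mul_mul_self c 1
    rwa [mul_one, hc, zero_smul, zero_add, conj_one] at h
  obtain ⟨α, β, α', β', κ, l, y, y', hβ, hκ, hl, h₁⟩ : ∃ (α β α' β' κ l : k) (y y' : Octonion k),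
      β ≠ 0 ∧ κ ≠ 0 ∧ l ≠ 0 ∧
        SameOrbit x ![mk 0 α β y 0 (κ • 1), mk 0 α' β' y' (l • 1) 0] := by
    have h₁ := ho.trans (SameOrbit.of_GE6 (g₃ * g₂ * g₁) _ _)
    have e : x₃ + -(x₂.norm⁻¹ • (conj x₂ * (x₂ * x₃))) = 0 := by
      rw [conj_mul_mul, inv_smul_smul₀ hn, add_neg_cancel]
    simp only [Subgroup.coe_mul, LinearEquiv.mul_apply, base, hg₁, hg₂, hg₃, conj_conj, e,
      conj_zero, zero_mul, mul_zero, add_zero, mul_one, smul_zero, neg_zero, sq b hb,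
      sq (conj (x₂ * b)) (by rwa [tr_conj]), mul_neg, neg_mul, mul_smul_comm, smul_mul_assoc,
      mul_conj, smul_neg, neg_neg, smul_smul] at h₁
    refine ⟨_, _, _, _, _, _, _, _, ?_, ?_, ?_, h₁⟩
    · exact mul_ne_zero hbn' (mul_ne_zero hbn' (mul_ne_zero hbn hbn))
    · exact mul_ne_zero hbn hbn'
    · exact mul_ne_zero hbn' (mul_ne_zero hbn (by rwa [Octonion.norm_conj] at hbn'))
  have h₂ := (h₁.trans (SameOrbit.smul_left (inv_ne_zero hκ) _ _)).trans
    (SameOrbit.smul_right (inv_ne_zero hl) _ _)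
  -- `g₄` clears x₁ of the second component by means of its x₂, and `g₅` that of the first by means
  -- of its x₃. Neither disturbs the other x₁, as the entry it would use is zero there.
  obtain ⟨g₄, hg₄⟩ := exists_add_row₂₁ (-(l⁻¹ • y'))
  obtain ⟨g₅, hg₅⟩ := exists_add_row₃₁ (conj (-(κ⁻¹ • y)))
  have h₃ := h₂.trans (SameOrbit.of_GE6 (g₅ * g₄) _ _)
  simp only [Subgroup.coe_mul, LinearEquiv.mul_apply, smul_mk, hg₄, hg₅, inv_smul_smul₀ hκ,
    inv_smul_smul₀ hl, conj_one, mul_one, mul_zero, conj_zero, add_neg_cancel, conj_conj,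
    zero_smul, smul_zero, zero_mul, add_zero, tr_zero, one_mul] at h₃
  exact ⟨_, _, _, _, mul_ne_zero (inv_ne_zero hκ) hβ, h₃⟩

end

section

/-! ### The stabilizer of a letter -/

/-- Permutations of three letters as permutations of four letters. -/
def permStabilizer : Equiv.Perm (Fin 3) →* S :=
  (Equiv.Perm.extendDomainHom (finSuccAboveEquiv (3 : Fin 4))).codRestrict S fun σ =>
    Equiv.Perm.extendDomain_apply_not_subtype σ _ (by simp)

theorem permStabilizer_castSucc (σ : Equiv.Perm (Fin 3)) (j : Fin 3) :
    (permStabilizer σ : Equiv.Perm (Fin 4)) j.castSucc = (σ j).castSucc := by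
  have h := Equiv.Perm.extendDomain_apply_image σ (finSuccAboveEquiv (3 : Fin 4)) j
  have e : ∀ i : Fin 3, (((finSuccAboveEquiv (3 : Fin 4)) i : {x // x ≠ (3 : Fin 4)}) : Fin 4)
      = i.castSucc := fun i => Fin.succAbove_last_apply i
  rw [e, e] at h
  exact h

theorem permStabilizer_last (σ : Equiv.Perm (Fin 3)) :
    (permStabilizer σ : Equiv.Perm (Fin 4)) (Fin.last 3) = Fin.last 3 :=
  (permStabilizer σ).2

theorem permStabilizer_bijective : Function.Bijective permStabilizer := by
  constructor
  · intro σ τ h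
    ext j
    have := permStabilizer_castSucc σ j
    rw [h, permStabilizer_castSucc, Fin.castSucc_inj] at this
    rw [this]
  · rintro ⟨f, hf⟩
    have hf' : f (Fin.last 3) = Fin.last 3 := hf
    have hne : ∀ j : Fin 3, f j.castSucc ≠ Fin.last 3 := fun j h =>
      (Fin.castSucc_lt_last j).ne (f.injective (h.trans hf'.symm))
    have hinj : Function.Injective fun j : Fin 3 => (f j.castSucc).castPred (hne j) := by
      intro i j h
      simpa using h
    refine ⟨Equiv.ofBijective _ (Finite.injective_iff_bijective.1 hinj),
      Subtype.ext (Equiv.ext fun j => ?_)⟩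
    induction j using Fin.lastCases with
    | last => rw [permStabilizer_last, hf']
    | cast j => simp [permStabilizer_castSucc]

/-! ### Cubic polynomials and the separable closure -/

variable {k : Type*} [Field k]

/-- A cubic form with nonzero discriminant has three distinct roots in the separable closure. -/
theorem exists_roots_of_discr_ne_zero (P : Cubic k) (ha : P.a ≠ 0) (hP : P.discr ≠ 0) :
    ∃ z : Fin 3 → SeparableClosure k, Function.Injective z ∧
      ∀ {E : Type*} [Field E] (g : SeparableClosure k →+* E) (w u : E),
        g (algebraMap k _ P.a) * w ^ 3 + g (algebraMap k _ P.b) * w ^ 2 * u +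
          g (algebraMap k _ P.c) * w * u ^ 2 + g (algebraMap k _ P.d) * u ^ 3 =
        g (algebraMap k _ P.a) * ((w - g (z 0) * u) * (w - g (z 1) * u) * (w - g (z 2) * u)) := by
  have h0 : P.toPoly ≠ 0 := Cubic.ne_zero_of_a_ne_zero ha
  -- Distinct roots in the algebraic closure mean separability, so the cubic already splits over the
  -- separable closure.
  have hsep : P.toPoly.Separable := by
    have hs : (P.toPoly.map (algebraMap k (AlgebraicClosure k))).Splits :=
      IsAlgClosed.splits _
    have := (Cubic.discr_ne_zero_iff_roots_nodup ha hs).1 hP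
    rw [Cubic.map_roots, Polynomial.nodup_roots_iff_of_splits
      ((Polynomial.map_ne_zero_iff (algebraMap k _).injective).2 h0) hs,
      Polynomial.separable_map] at this
    exact this
  have hs := IsSepClosed.splits_codomain (f := algebraMap k (SeparableClosure k)) P.toPoly hsep
  obtain ⟨x, y, z, h3⟩ := (Cubic.splits_iff_roots_eq_three ha).1 hs
  obtain ⟨hxy, hxz, hyz⟩ := (Cubic.discr_ne_zero_iff_roots_ne ha h3).1 hP
  refine ⟨![x, y, z], ?_, fun g w u => ?_⟩
  · intro i j hij
    fin_cases i <;> fin_cases j <;> simp_all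
  · rw [Cubic.b_eq_three_roots ha h3, Cubic.c_eq_three_roots ha h3, Cubic.d_eq_three_roots ha h3]
    simp
    ring

/-- A finite family of elements of the separable closure, permuted by the Galois group. -/
theorem exists_contHom_of_permutes {n : ℕ} (z : Fin n → SeparableClosure k)
    (hz : Function.Injective z) (h : ∀ (σ : GalSep k) j, ∃ i, σ (z j) = z i) :
    ∃ φ : ContHom (GalSep k) (Equiv.Perm (Fin n)), ∀ σ j, σ (z j) = z (φ.1 σ j) := by
  choose e he using h
  let act : MulAction (GalSep k) (Fin n) :=
    { smul := fun σ j => e σ j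
      one_smul := fun j => hz (he 1 j).symm
      mul_smul := fun σ τ j => hz <| by
        change z (e (σ * τ) j) = z (e σ (e τ j))
        rw [← he, ← he, ← he]
        rfl }
  refine ⟨⟨MulAction.toPermHom (GalSep k) (Fin n), ?_⟩, he⟩
  have hfin : FiniteDimensional k (IntermediateField.adjoin k (Set.range z)) :=
    IntermediateField.finiteDimensional_adjoin fun x _ => Algebra.IsIntegral.isIntegral x
  -- The kernel contains the fixing subgroup of the finite extension generated by the `z j`, which
  -- is open.
  refine Subgroup.isOpen_mono (fun σ hσ => ?_)
    (IntermediateField.fixingSubgroup_isOpen (IntermediateField.adjoin k (Set.range z)))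
  refine Equiv.ext fun j => hz ?_
  change z (e σ j) = z j
  rw [← he]
  exact hσ ⟨z j, IntermediateField.subset_adjoin k _ ⟨j, rfl⟩⟩

/-! ### The normal form -/

/-- The pair of conics `2xy + sy² + tz² = 0` and `2xz + s'y² + t'z² = 0`. -/
def conicPair (s t s' t' : k) : QPair k :=
  ![⟨!![0, 1, 0; 1, s, 0; 0, 0, t], by
      ext i j
      fin_cases i <;> fin_cases j <;> rfl⟩,
    ⟨!![0, 0, 1; 0, s', 0; 1, 0, t'], by
      ext i j
      fin_cases i <;> fin_cases j <;> rfl⟩]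

theorem toV_conicPair (s t s' t' : k) :
    (conicPair s t s' t').toV = ![J.mk 0 s t 0 0 1, J.mk 0 s' t' 0 1 0] := by
  funext i
  fin_cases i
  · refine Prod.ext (funext fun j => ?_) (funext fun j => ?_)
    · fin_cases j <;> rfl
    · fin_cases j
      · exact zero_smul k _
      · exact zero_smul k _
      · exact one_smul k _
  · refine Prod.ext (funext fun j => ?_) (funext fun j => ?_)
    · fin_cases j <;> rfl
    · fin_cases j
      · exact zero_smul k _
      · exact one_smul k _
      · exact zero_smul k _

theorem binaryCubic_conicPair (h2 : (2 : k) ≠ 0) (s t s' t' : k) :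
    binaryCubic (fun A : TernaryForm k => (A : Matrix (Fin 3) (Fin 3) k).det)
      (conicPair s t s' t') = ⟨-t, -t', -s, -s'⟩ := by
  refine Cubic.ext ?_ ?_ ?_ ?_
  · simp [binaryCubic, conicPair, Matrix.det_fin_three]
  · simp [binaryCubic, conicPair, Matrix.det_fin_three]
    field_simp
    ring
  · simp [binaryCubic, conicPair, Matrix.det_fin_three]
    field_simp
    ring
  · simp [binaryCubic, conicPair, Matrix.det_fin_three]

theorem conicPair_mem_QPairss (h2 : (2 : k) ≠ 0) {s t s' t' : k}
    (h : ![J.mk 0 s t 0 0 1, J.mk 0 s' t' 0 1 0] ∈ Vss k) : conicPair s t s' t' ∈ QPairss k := by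
  have e := binaryCubic_eq h2 (x := ![J.mk 0 s t 0 0 1, J.mk 0 s' t' 0 1 0]) (p := -t') (q := -s)
    (fun u v => by
      simp [J.smul_mk, J.mk_add, J.det_mk, Octonion.norm_smul, Octonion.norm_zero,
        Octonion.norm_one]
      ring)
  have h' : (binaryCubic J.det ![J.mk 0 s t 0 0 1, J.mk 0 s' t' 0 1 0]).discr ≠ 0 := h
  rw [e] at h'
  change (binaryCubic _ _).discr ≠ 0
  rw [binaryCubic_conicPair h2]
  simpa [J.det_mk, Octonion.norm_zero, Octonion.norm_one] using h'

/-- The chosen representative is a unit multiple of `v`, so each quadratic equation only scales by a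
square. -/
theorem mk_mem_zeroP2_conicPair (s t s' t' : k) (v : Fin 3 → AlgebraicClosure k) (hv : v ≠ 0) :
    Projectivization.mk _ v hv ∈ zeroP2 (conicPair s t s' t') ↔
      2 * v 0 * v 1 + algebraMap k _ s * v 1 ^ 2 + algebraMap k _ t * v 2 ^ 2 = 0 ∧
      2 * v 0 * v 2 + algebraMap k _ s' * v 1 ^ 2 + algebraMap k _ t' * v 2 ^ 2 = 0 := by
  obtain ⟨a, ha⟩ := Projectivization.exists_smul_eq_mk_rep (AlgebraicClosure k) v hv
  have ha0 : (a : AlgebraicClosure k) ^ 2 ≠ 0 := pow_ne_zero 2 a.ne_zero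
  have e : ∀ i, (Projectivization.mk _ v hv).rep i = a * v i := fun i => (congrFun ha i).symm
  change (∀ i : Fin 2, _) ↔ _
  rw [Fin.forall_fin_two]
  have h0 : (Projectivization.mk (AlgebraicClosure k) v hv).rep ⬝ᵥ
      (((conicPair s t s' t') 0).1.map (algebraMap k (AlgebraicClosure k)) *ᵥ
        (Projectivization.mk (AlgebraicClosure k) v hv).rep) = (a : AlgebraicClosure k) ^ 2 *
      (2 * v 0 * v 1 + algebraMap k _ s * v 1 ^ 2 + algebraMap k _ t * v 2 ^ 2) := by
    simp [conicPair, dotProduct, Matrix.mulVec, Fin.sum_univ_three, e]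
    ring
  have h1 : (Projectivization.mk (AlgebraicClosure k) v hv).rep ⬝ᵥ
      (((conicPair s t s' t') 1).1.map (algebraMap k (AlgebraicClosure k)) *ᵥ
        (Projectivization.mk (AlgebraicClosure k) v hv).rep) = (a : AlgebraicClosure k) ^ 2 *
      (2 * v 0 * v 2 + algebraMap k _ s' * v 1 ^ 2 + algebraMap k _ t' * v 2 ^ 2) := by
    simp [conicPair, dotProduct, Matrix.mulVec, Fin.sum_univ_three, e]
    ring
  rw [h0, h1, mul_eq_zero_iff_left ha0, mul_eq_zero_iff_left ha0]

theorem map_mk_conicPoint {K L : Type*} [Field K] [Field L] (g : K →+* L) (a z : K) :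
    P2.map g (.mk K ![a, 1, z] (fun h => one_ne_zero (congrFun h 1))) =
      .mk L ![g a, 1, g z] (fun h => one_ne_zero (congrFun h 1)) := by
  refine Projectivization.mk_eq_mk_iff' .. |>.2 ⟨1, ?_⟩
  rw [one_smul]
  funext i
  fin_cases i <;> simp

theorem map_mk_vertex {K L : Type*} [Field K] [Field L] (g : K →+* L) :
    P2.map g (.mk K ![1, 0, 0] (fun h => one_ne_zero (congrFun h 0))) =
      .mk L ![1, 0, 0] (fun h => one_ne_zero (congrFun h 0)) := by
  refine Projectivization.mk_eq_mk_iff' .. |>.2 ⟨1, ?_⟩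
  rw [one_smul]
  funext i
  fin_cases i <;> simp

theorem vertex_mem_zeroP2_conicPair (s t s' t' : k) :
    .mk (AlgebraicClosure k) ![1, 0, 0] (fun h => one_ne_zero (congrFun h 0)) ∈
      zeroP2 (conicPair s t s' t') := by
  rw [mk_mem_zeroP2_conicPair]
  simp

/-- The points of the intersection of the two conics, in terms of the roots of a cubic. -/
theorem exists_points_conicPair (h2 : (2 : k) ≠ 0) {s t s' t' : k} (ht : t ≠ 0)
    (h : conicPair s t s' t' ∈ QPairss k) :
    ∃ (z : Fin 3 → SeparableClosure k) (p : Fin 4 → P2 (SeparableClosure k)),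
      Function.Injective z ∧ Function.Injective p ∧
      (∀ (σ : GalSep k) j, ∃ i, σ (z j) = z i) ∧
      (∀ (σ : GalSep k) (i j : Fin 3), σ (z j) = z i →
        P2.map (σ : SeparableClosure k →+* SeparableClosure k) (p j.castSucc) = p i.castSucc) ∧
      (∀ σ : GalSep k, P2.map (σ : SeparableClosure k →+* SeparableClosure k) (p (Fin.last 3)) =
        p (Fin.last 3)) ∧
      Set.range (fun j =>
        P2.map (algebraMap (SeparableClosure k) (AlgebraicClosure k)) (p j)) =
          zeroP2 (conicPair s t s' t') := by
  -- This cubic is F_x(-w, u); the change of sign preserves the discriminant.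
  have hdisc : Cubic.discr ⟨t, -t', s, -s'⟩ ≠ 0 := by
    have h' : (binaryCubic (fun A : TernaryForm k => (A : Matrix (Fin 3) (Fin 3) k).det)
      (conicPair s t s' t')).discr ≠ 0 := h
    rw [binaryCubic_conicPair h2] at h'
    convert h' using 1
    simp only [Cubic.discr]
    ring
  obtain ⟨z, hz, hP⟩ := exists_roots_of_discr_ne_zero ⟨t, -t', s, -s'⟩ ht hdisc
  set f := algebraMap k (SeparableClosure k) with hf
  set F := algebraMap (SeparableClosure k) (AlgebraicClosure k) with hF
  have hFf : ∀ x, algebraMap k (AlgebraicClosure k) x = F (f x) := fun x => rfl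
  have hft : f t ≠ 0 := (map_ne_zero f).2 ht
  have h2' : (2 : SeparableClosure k) ≠ 0 := by
    have := (map_ne_zero f).2 h2
    rwa [map_ofNat] at this
  have h2'' : (2 : AlgebraicClosure k) ≠ 0 := by
    have := (map_ne_zero F).2 h2'
    rwa [map_ofNat] at this
  have hprod : ∀ {E : Type _} [Field E] (g : SeparableClosure k →+* E) (w u : E),
      (w - g (z 0) * u) * (w - g (z 1) * u) * (w - g (z 2) * u) = 0 → ∃ j, w = g (z j) * u := by
    intro E _ g w u h
    rcases mul_eq_zero.1 h with h | h
    · rcases mul_eq_zero.1 h with h | h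
      · exact ⟨0, sub_eq_zero.1 h⟩
      · exact ⟨1, sub_eq_zero.1 h⟩
    · exact ⟨2, sub_eq_zero.1 h⟩
  have hroot : ∀ j, f t * z j ^ 3 - f t' * z j ^ 2 + f s * z j - f s' = 0 := by
    intro j
    have e := hP (RingHom.id _) (z j) 1
    have e' : (z j - z 0) * (z j - z 1) * (z j - z 2) = 0 := by
      fin_cases j <;> simp
    simp only [RingHom.id_apply, mul_one, map_neg, one_pow, e', mul_zero] at e
    linear_combination e
  -- At y = 1 the first conic gives x in terms of z = w, and the second becomes the cubic equation
  -- for w.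
  let pt : SeparableClosure k → P2 (SeparableClosure k) := fun w =>
    .mk _ ![-(f s + f t * w ^ 2) / 2, 1, w] (fun h => one_ne_zero (congrFun h 1))
  let q : P2 (SeparableClosure k) := .mk _ ![1, 0, 0] (fun h => one_ne_zero (congrFun h 0))
  refine ⟨z, Fin.snoc (α := fun _ => P2 (SeparableClosure k)) (fun j => pt (z j)) q, hz, ?_, ?_, ?_,
    ?_, ?_⟩
  · have hpt : ∀ v w, pt v = pt w → v = w := by
      intro v w h
      obtain ⟨a, ha⟩ := (Projectivization.mk_eq_mk_iff' ..).1 h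
      have h1 := congrFun ha 1
      have h2 := congrFun ha 2
      simp at h1 h2
      rw [h1, one_mul] at h2
      exact h2.symm
    have hq : ∀ v, pt v ≠ q := by
      intro v h
      obtain ⟨a, ha⟩ := (Projectivization.mk_eq_mk_iff' ..).1 h
      have h1 := congrFun ha 1
      simp at h1
    intro i j hij
    induction i using Fin.lastCases with
    | last =>
      induction j using Fin.lastCases with
      | last => rfl
      | cast j =>
        rw [Fin.snoc_last, Fin.snoc_castSucc] at hij
        exact absurd hij.symm (hq _)
    | cast i =>
      induction j using Fin.lastCases with
      | last =>
        rw [Fin.snoc_last, Fin.snoc_castSucc] at hij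
        exact absurd hij (hq _)
      | cast j =>
        rw [Fin.snoc_castSucc, Fin.snoc_castSucc] at hij
        rw [hz (hpt _ _ hij)]
  · intro σ j
    have e := hP (RingHom.id _) (σ (z j)) 1
    have e' := congrArg σ (hroot j)
    simp only [map_add, map_sub, map_mul, map_pow, map_zero, hf, AlgEquiv.commutes] at e'
    rw [← hf] at e'
    have e'' : (σ (z j) - z 0) * (σ (z j) - z 1) * (σ (z j) - z 2) = 0 := by
      refine (mul_eq_zero.1 ?_).resolve_left hft
      simp only [RingHom.id_apply, mul_one, map_neg, one_pow] at e
      rw [← e]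
      linear_combination e'
    obtain ⟨i, hi⟩ := hprod (RingHom.id _) (σ (z j)) 1 (by simpa using e'')
    exact ⟨i, by simpa using hi⟩
  · intro σ i j hij
    rw [Fin.snoc_castSucc, Fin.snoc_castSucc, map_mk_conicPoint]
    have e : (σ : SeparableClosure k →+* SeparableClosure k) (-(f s + f t * z j ^ 2) / 2) =
        -(f s + f t * z i ^ 2) / 2 := by
      change σ _ = _
      simp only [map_div₀, map_neg, map_add, map_mul, map_pow, hij, map_ofNat, hf,
        AlgEquiv.commutes]
    have e' : (σ : SeparableClosure k →+* SeparableClosure k) (z j) = z i := hij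
    simp only [e, e', pt]
  · intro σ
    rw [Fin.snoc_last]
    exact map_mk_vertex _
  · ext P
    constructor
    · rintro ⟨j, rfl⟩
      induction j using Fin.lastCases with
      | last =>
        change P2.map F (Fin.snoc (α := fun _ => P2 (SeparableClosure k)) _ q (Fin.last 3)) ∈ _
        rw [Fin.snoc_last, map_mk_vertex]
        exact vertex_mem_zeroP2_conicPair s t s' t'
      | cast j =>
        change P2.map F (Fin.snoc (α := fun _ => P2 (SeparableClosure k)) _ q j.castSucc) ∈ _
        rw [Fin.snoc_castSucc, map_mk_conicPoint, mk_mem_zeroP2_conicPair]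
        have e := congrArg F (hroot j)
        simp only [map_add, map_sub, map_mul, map_pow, map_zero] at e
        simp only [Matrix.cons_val_zero, Matrix.cons_val_one, Matrix.cons_val, hFf, map_div₀,
          map_neg, map_add, map_mul, map_pow, map_ofNat]
        constructor
        · field_simp
          ring
        · field_simp
          linear_combination -e
    · induction P using Projectivization.ind with | _ v hv
      rw [mk_mem_zeroP2_conicPair]
      rintro ⟨h0, h1⟩
      have hFt : F (f t) ≠ 0 := (map_ne_zero F).2 hft
      have e := hP F (v 2) (v 1)
      -- Elimination of x: z times the first equation minus y times the second is the homogeneous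
      -- cubic in (z, y).
      obtain ⟨j, hj⟩ := hprod F (v 2) (v 1) (by
        refine (mul_eq_zero.1 (e.symm.trans ?_)).resolve_left hFt
        simp only [map_neg]
        rw [hFf, hFf] at h0 h1
        linear_combination v 2 * h0 - v 1 * h1)
      -- If y = 0 then z = 0 as well, which leaves only the vertex.
      by_cases hv1 : v 1 = 0
      · have hv2 : v 2 = 0 := by rw [hj, hv1, mul_zero]
        refine ⟨Fin.last 3, ?_⟩
        change P2.map F (Fin.snoc (α := fun _ => P2 (SeparableClosure k)) _ q (Fin.last 3)) = _
        rw [Fin.snoc_last, map_mk_vertex, eq_comm]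
        refine Projectivization.mk_eq_mk_iff' .. |>.2 ⟨v 0, ?_⟩
        funext i
        fin_cases i <;> simp [hv1, hv2]
      · refine ⟨j.castSucc, ?_⟩
        change P2.map F (Fin.snoc (α := fun _ => P2 (SeparableClosure k)) _ q j.castSucc) = _
        rw [Fin.snoc_castSucc, map_mk_conicPoint, eq_comm]
        refine Projectivization.mk_eq_mk_iff' .. |>.2 ⟨v 1, ?_⟩
        rw [hFf, hFf, hj] at h0
        have h0' : 2 * v 0 + v 1 * (F (f s) + F (f t) * F (z j) ^ 2) = 0 := by
          refine (mul_eq_zero.1 ?_).resolve_left hv1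
          linear_combination h0
        have hF2 : F 2 = 2 := map_ofNat F 2
        funext i
        fin_cases i
        · simp [hF2]
          field_simp
          linear_combination -h0'
        · simp
        · simp [hj, mul_comm]

/-- Galois permutes the first three points as it permutes the roots and fixes the last, so its
action factors through `permStabilizer`. -/
theorem exists_isClassOf_conicPair (h2 : (2 : k) ≠ 0) {s t s' t' : k} (ht : t ≠ 0)
    (h : conicPair s t s' t' ∈ QPairss k) :
    ∃ c : H1 (GalSep k) S, IsClassOf (conicPair s t s' t') (H1.map S.subtype c) := by
  obtain ⟨z, p, hz, hp, hperm, hcast, hlast, hrange⟩ := exists_points_conicPair h2 ht h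
  obtain ⟨φ, hφ⟩ := exists_contHom_of_permutes z hz hperm
  let ψ : ContHom (GalSep k) S := ⟨permStabilizer.comp φ.1, Subgroup.isOpen_mono
    (fun σ hσ => by
      rw [MonoidHom.mem_ker] at hσ ⊢
      rw [MonoidHom.comp_apply, hσ, map_one]) φ.2⟩
  refine ⟨Quotient.mk _ ψ, p, hp, hrange, ⟨S.subtype.comp ψ.1, Subgroup.isOpen_mono
    (fun σ hσ => by
      rw [MonoidHom.mem_ker] at hσ ⊢
      rw [MonoidHom.comp_apply, hσ, map_one]) ψ.2⟩, fun σ j => ?_, rfl⟩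
  change _ = p ((permStabilizer (φ.1 σ) : Equiv.Perm (Fin 4)) j)
  induction j using Fin.lastCases with
  | last => rw [permStabilizer_last, hlast]
  | cast j => rw [permStabilizer_castSucc, hcast σ _ _ (hφ σ j)]

end

end JordanPairs

end

theorem mainTheorem2 {k : Type*} [Field k] [Infinite k] (h2 : (2 : k) ≠ 0) (h3 : (3 : k) ≠ 0) :
    Nonempty (S ≃* Equiv.Perm (Fin 3)) ∧
    ∀ y ∈ Vss k, ∃ x ∈ QPairss k,
      x.toV ∈ MulAction.orbit (G k) y ∧
      (∃ q : P2 k, P2.map (algebraMap k (AlgebraicClosure k)) q ∈ zeroP2 x) ∧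
      ∃ c : H1 (GalSep k) S, IsClassOf x (H1.map S.subtype c) := by
  refine ⟨⟨(MulEquiv.ofBijective permStabilizer permStabilizer_bijective).symm⟩, fun y hy => ?_⟩
  obtain ⟨s, t, s', t', ht, h⟩ := (hasIsotropicRow_of_mem_Vss h2 hy).exists_sameOrbit
  have hx := conicPair_mem_QPairss h2 (h.mem_Vss h2 hy)
  refine ⟨conicPair s t s' t', hx, ?_,
    ⟨.mk k ![1, 0, 0] (fun h => one_ne_zero (congrFun h 0)), ?_⟩, exists_isClassOf_conicPair h2 ht hx⟩
  · rw [toV_conicPair]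
    exact h
  · rw [map_mk_vertex]
    exact vertex_mem_zeroP2_conicPair s t s' t'
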